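/- Let $\|x\|$ denote the distance from the real number $x$ to its nearest integer, $\sharp S$ the cardinality of a finite set $S$, and $\dim$ the Hausdorff dimension. For an integer $b\ge 2$ and a real number $\xi$, let $v_b(\xi)\in[0,+\infty]$ be the supremum of the real numbers $v$ for which $\|b^n\xi\|<(b^n)^{-v}$ has infinitely many solutions in positive integers $n$, and let $\hat v_b(\xi)\in[0,+\infty]$ be the supremum of the real numbers $v$ for which, for every sufficiently large integer $N$, the inequality $\|b^n\xi\|<(b^N)^{-v}$ has a solution $n$ with $1\le n\le N$. **Theorem 6.1.** Let $b\ge 3$ be an integer and let $S$ be a subset of $\{0,1,\dots,b-1\}$ of cardinality at least two that contains at least one of the digits $0$ and $b-1$. Let $K_{b,S}$ be the set of real numbers $\xi\in[0,1]$ that can be written as $\xi=\sum_{j\ge1}a_jb^{-j}$ with $a_j\in S$ for all $j\ge1$. (i) Let $\theta$ and $\hat v$ be positive real numbers with $\hat v<1$. If $\theta<1/(1-\hat v)$, then the set $$\{\xi\in K_{b,S}:\hat v_b(\xi)\ge\hat v\}\cap\{\xi\in K_{b,S}:v_b(\xi)=\theta\hat v\}$$ is empty. If $\theta\ge 1/(1-\hat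 v)$, then $$\dim\bigl(\{\xi\in K_{b,S}:\hat v_b(\xi)=\hat v\}\cap\{\xi\in K_{b,S}:v_b(\xi)=\theta\hat v\}\bigr)=\frac{\log\sharp S}{\log b}\cdot\frac{\theta-1-\theta\hat v}{(1+\theta\hat v)(\theta-1)}.$$ (ii) $\dim\{\xi\in K_{b,S}:\hat v_b(\xi)=1\}=0$. (iii) For every real number $\hat v\in[0,1]$, $$\dim\{\xi\in K_{b,S}:\hat v_b(\xi)\ge\hat v\}=\dim\{\xi\in K_{b,S}:\hat v_b(\xi)=\hat v\}=\frac{\log\sharp S}{\log b}\cdot\Bigl(\frac{1-\hat v}{1+\hat v}\Bigr)^2.$$ -/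

import Mathlib

namespace BaryApprox

noncomputable section

/-- The distance from the real number `x` to its nearest integer. -/
def distInt (x : ℝ) : ℝ := |x - (round x : ℝ)|

/-- The exponent `v_b(ξ)`: the supremum, in the extended reals, of the real numbers `v` such that
`‖b ^ n ξ‖ < (b ^ n) ^ (-v)` has infinitely many solutions in positive integers `n`. -/
def vExp (b : ℕ) (ξ : ℝ) : EReal :=
  sSup ((fun v : ℝ => (v : EReal)) ''
    {v : ℝ | {n : ℕ | 0 < n ∧ distInt ((b : ℝ) ^ n * ξ) < ((b : ℝ) ^ n) ^ (-v)}.Infinite})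

/-- The uniform exponent `v̂_b(ξ)`: the supremum, in the extended reals, of the real numbers `v`
such that, for every sufficiently large integer `N`, the inequality
`‖b ^ n ξ‖ < (b ^ N) ^ (-v)` has a solution `n` with `1 ≤ n ≤ N`. -/
def vHatExp (b : ℕ) (ξ : ℝ) : EReal :=
  sSup ((fun v : ℝ => (v : EReal)) ''
    {v : ℝ | ∃ N₀ : ℕ, ∀ N : ℕ, N₀ ≤ N →
      ∃ n : ℕ, 1 ≤ n ∧ n ≤ N ∧ distInt ((b : ℝ) ^ n * ξ) < ((b : ℝ) ^ N) ^ (-v)})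

/-- The set `K_{b,S}` of the real numbers in `[0, 1]` that have a `b`-ary expansion
`∑_{j ≥ 1} a_j / b ^ j` with all its digits in `S` (here `a j` is the digit `a_{j+1}`). -/
def cantorSet (b : ℕ) (S : Finset ℕ) : Set ℝ :=
  {ξ : ℝ | ξ ∈ Set.Icc (0 : ℝ) 1 ∧
    ∃ a : ℕ → ℕ, (∀ j, a j ∈ S) ∧ HasSum (fun j : ℕ => (a j : ℝ) / (b : ℝ) ^ (j + 1)) ξ}

end

end BaryApprox

namespace BaryApprox

open MeasureTheory Filter Topology
open scoped ENNReal NNReal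

/-! Up to a bounded error in `L`, the inequality `‖b ^ n ξ‖ < b ^ (-L)` says that the `L` digits
from position `n` on are all `0` or all `b - 1`. Both exponents therefore measure run lengths: `v_b`
compares a run with its own position `n`, and `v̂_b` asks that for every large `N` a run of length
about `v̂ N` begins by position `N`. Write `s = #S`.

Upper bounds. Let `v < v̂_b` and `v_b < w`, and let `n` be a start, that is, a position where the
digit changes. The uniform condition at `N = n - 1` gives a run of length `L ≈ v n`, which must end
before `n`; extended to the left it begins at an earlier start `m`, with `L ≤ w m + O(1)`. The word
before `n` is thus the word before `m`, then `L` forced digits, then free digits. By induction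
(`exists_startWords_count`) there are `O(s ^ (β n))` such words for every `β ≤ 1` above `1 - v w /
(w - v)`. If `β < 0` is possible, no such sequence exists (`not_vExp_lt_of_lt_vHatExp`). Otherwise
runs of length about `v_b n` at starts `n` give coverings with diameters about `b ^ (-(1 + v_b) n)`,
hence the bound `(log s / log b) β / (1 + v_b)` (`dimH_strip_le`). With `v_b = θ v` this is the
formula in (i); maximized over `v_b` it gives the square in (iii) (`strip_ratio_le`).

Lower bounds. Put a digit `e ∈ {0, b - 1}` on the blocks `[θ ^ k, (1 + θ v) θ ^ k)`, mark the
remaining positions congruent to `0` and `1` modulo `q` by distinct digits `c` and `e` to prevent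
other long runs, and leave all else free. The exponents are then exactly `v` and `θ v`. Reading the
free digits in base `s` is a Hölder map onto `[0, 1)`, whose exponent is governed by the lower
density of free positions (`le_dimH_patternSet`, `count_longRuns_le`). Letting `q → ∞` yields the
formula. -/

/-- The digits of `a` at the positions `n, …, n + L - 1` are all `0` or all `b - 1`. -/
def IsRun (b : ℕ) (a : ℕ → ℕ) (n L : ℕ) : Prop :=
  (∀ j, n ≤ j → j < n + L → a j = 0) ∨ (∀ j, n ≤ j → j < n + L → a j = b - 1)

/-- The real number `0.a_n a_{n+1} …` in base `b`. -/
noncomputable def digitTail (b : ℕ) (a : ℕ → ℕ) (n : ℕ) : ℝ :=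
  ∑' j : ℕ, (a (n + j) : ℝ) / (b : ℝ) ^ (j + 1)

/-! ### Distance to the nearest integer and runs of digits -/

lemma distInt_nonneg (x : ℝ) : 0 ≤ distInt x := abs_nonneg _

lemma distInt_le_half (x : ℝ) : distInt x ≤ 1 / 2 := abs_sub_round x

lemma distInt_int_add (z : ℤ) (x : ℝ) : distInt (z + x) = distInt x := by
  simp [distInt, round_intCast_add]

lemma distInt_le_self {x : ℝ} (hx : 0 ≤ x) : distInt x ≤ x := by
  have := round_le x 0
  simpa [distInt, abs_of_nonneg hx] using this

lemma distInt_le_one_sub {x : ℝ} (hx : x ≤ 1) : distInt x ≤ 1 - x := by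
  have := round_le x 1
  rwa [abs_sub_comm x ((1 : ℤ) : ℝ), Int.cast_one, abs_of_nonneg (sub_nonneg.2 hx)] at this

lemma lt_or_one_sub_lt_of_distInt_lt {x r : ℝ} (h1 : x ≤ 1) (h0 : 0 ≤ x) (h : distInt x < r) :
    x < r ∨ 1 - x < r := by
  rw [distInt, abs_sub_round_eq_min] at h
  rcases h1.eq_or_lt with rfl | h1
  · right
    simpa using h
  · rw [Int.fract_eq_self.2 ⟨h0, h1⟩] at h
    exact min_lt_iff.1 h

section Tail

variable {b : ℕ} {a : ℕ → ℕ}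

lemma hasSum_geometric_top (hb : 2 ≤ b) :
    HasSum (fun j : ℕ => ((b : ℝ) - 1) / (b : ℝ) ^ (j + 1)) 1 := by
  have hb' : (1 : ℝ) < b := by exact_mod_cast hb
  have h := (hasSum_geometric_of_lt_one (r := (b : ℝ)⁻¹) (by positivity)
    (inv_lt_one_of_one_lt₀ hb')).mul_left (((b : ℝ) - 1) / b)
  have e1 : ((b : ℝ) - 1) / b * (1 - (b : ℝ)⁻¹)⁻¹ = 1 := by
    have : (b : ℝ) - 1 ≠ 0 := by linarith
    field_simp
  rw [e1] at h
  refine h.congr_fun fun j => ?_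
  rw [pow_succ, inv_pow]
  field_simp

lemma digit_le_sub_one (hb : 2 ≤ b) (ha : ∀ j, a j ≤ b - 1) (j : ℕ) :
    (a j : ℝ) ≤ (b : ℝ) - 1 := by
  have := ha j
  have h2 : a j + 1 ≤ b := by omega
  have : (a j : ℝ) + 1 ≤ b := by exact_mod_cast h2
  linarith

lemma summable_digits (hb : 2 ≤ b) (ha : ∀ j, a j ≤ b - 1) :
    Summable (fun j : ℕ => (a j : ℝ) / (b : ℝ) ^ (j + 1)) :=
  Summable.of_nonneg_of_le (fun j => by positivity)
    (fun j => by gcongr; exact digit_le_sub_one hb ha j) (hasSum_geometric_top hb).summable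

lemma summable_digits_shift (hb : 2 ≤ b) (ha : ∀ j, a j ≤ b - 1) (n : ℕ) :
    Summable (fun j : ℕ => (a (n + j) : ℝ) / (b : ℝ) ^ (j + 1)) :=
  summable_digits (a := fun j => a (n + j)) hb (fun j => ha (n + j))

lemma digitTail_nonneg (n : ℕ) : 0 ≤ digitTail b a n :=
  tsum_nonneg fun j => by positivity

lemma digitTail_le_one (hb : 2 ≤ b) (ha : ∀ j, a j ≤ b - 1) (n : ℕ) : digitTail b a n ≤ 1 := by
  refine hasSum_le (fun j => ?_) (summable_digits_shift hb ha n).hasSum (hasSum_geometric_top hb)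
  gcongr
  exact digit_le_sub_one hb ha _

lemma digitTail_succ (hb : 2 ≤ b) (ha : ∀ j, a j ≤ b - 1) (n : ℕ) :
    (b : ℝ) * digitTail b a n = a n + digitTail b a (n + 1) := by
  have hb' : (b : ℝ) ≠ 0 := by positivity
  have h := (summable_digits_shift hb ha n).tsum_eq_zero_add
  rw [digitTail, h, digitTail, mul_add, ← tsum_mul_left]
  congr 1
  · simp
    field_simp
  · refine tsum_congr fun j => ?_
    rw [show n + (j + 1) = n + 1 + j by ring, pow_succ (b : ℝ) (j + 1)]
    field_simp

lemma digitTail_run_zero (hb : 2 ≤ b) (ha : ∀ j, a j ≤ b - 1) (n L : ℕ)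
    (h : ∀ j, n ≤ j → j < n + L → a j = 0) : digitTail b a n ≤ ((b : ℝ) ^ L)⁻¹ := by
  induction L generalizing n with
  | zero => simpa using digitTail_le_one hb ha n
  | succ L ih =>
    have hb' : (0 : ℝ) < b := by positivity
    have h1 := ih (n + 1) fun j hj hj' => h j (by omega) (by omega)
    have h2 := digitTail_succ hb ha n
    rw [h n le_rfl (by omega)] at h2
    rw [pow_succ, mul_inv, ← div_eq_mul_inv, le_div_iff₀ hb', mul_comm, h2]
    simpa using h1

/-- A single nonzero digit before position `n + L` already contributes at least `b ^ (-L)`. -/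
lemma digits_eq_zero_of_digitTail_lt (hb : 2 ≤ b) (ha : ∀ j, a j ≤ b - 1) (n L : ℕ)
    (h : digitTail b a n < ((b : ℝ) ^ L)⁻¹) : ∀ j, n ≤ j → j < n + L → a j = 0 := by
  intro j hj hj'
  by_contra hne
  refine h.not_ge ?_
  have h1 := (summable_digits_shift hb ha n).hasSum
  have h2 := le_hasSum h1 (j - n) fun i _ => by positivity
  refine le_trans ?_ h2
  rw [show n + (j - n) = j by omega]
  have h3 : (1 : ℝ) ≤ a j := by exact_mod_cast Nat.one_le_iff_ne_zero.2 hne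
  have hb' : (1 : ℝ) ≤ b := by exact_mod_cast (by omega : 1 ≤ b)
  rw [← one_div]
  apply div_le_div₀ (by positivity) h3 (by positivity)
  exact pow_le_pow_right₀ hb' (by omega)

/-- The reflection of digits exchanges `0` and `b - 1`, so only runs of zeros have to be treated
directly. -/
lemma digitTail_compl (hb : 2 ≤ b) (ha : ∀ j, a j ≤ b - 1) (n : ℕ) :
    digitTail b (fun j => b - 1 - a j) n = 1 - digitTail b a n := by
  have h := (hasSum_geometric_top hb).sub (summable_digits_shift hb ha n).hasSum
  refine (h.congr_fun ?_).tsum_eq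
  intro j
  rw [Nat.cast_sub (ha _), Nat.cast_sub (by omega)]
  simp [sub_div]

lemma exists_int_add_digitTail (hb : 2 ≤ b) (ha : ∀ j, a j ≤ b - 1) {ξ : ℝ}
    (hξ : HasSum (fun j : ℕ => (a j : ℝ) / (b : ℝ) ^ (j + 1)) ξ) (n : ℕ) :
    ∃ z : ℤ, (b : ℝ) ^ n * ξ = z + digitTail b a n := by
  induction n with
  | zero => exact ⟨0, by simp [digitTail, hξ.tsum_eq]⟩
  | succ n ih =>
    obtain ⟨z, hz⟩ := ih
    refine ⟨b * z + a n, ?_⟩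
    rw [pow_succ', mul_assoc, hz, mul_add, digitTail_succ hb ha]
    push_cast
    ring

lemma isRun_of_distInt_lt (hb : 2 ≤ b) (ha : ∀ j, a j ≤ b - 1) {ξ : ℝ}
    (hξ : HasSum (fun j : ℕ => (a j : ℝ) / (b : ℝ) ^ (j + 1)) ξ) {n L : ℕ}
    (h : distInt ((b : ℝ) ^ n * ξ) < ((b : ℝ) ^ L)⁻¹) : IsRun b a n L := by
  obtain ⟨z, hz⟩ := exists_int_add_digitTail hb ha hξ n
  rw [hz, distInt_int_add] at h
  rcases lt_or_one_sub_lt_of_distInt_lt (digitTail_le_one hb ha n) (digitTail_nonneg n) h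
    with h | h
  · exact Or.inl (digits_eq_zero_of_digitTail_lt hb ha n L h)
  · right
    rw [← digitTail_compl hb ha] at h
    intro j hj hj'
    have := digits_eq_zero_of_digitTail_lt hb (fun j => by omega) n L h j hj hj'
    have := ha j
    omega

lemma IsRun.distInt_le (hb : 2 ≤ b) (ha : ∀ j, a j ≤ b - 1) {ξ : ℝ}
    (hξ : HasSum (fun j : ℕ => (a j : ℝ) / (b : ℝ) ^ (j + 1)) ξ) {n L : ℕ}
    (h : IsRun b a n L) : distInt ((b : ℝ) ^ n * ξ) ≤ ((b : ℝ) ^ L)⁻¹ := by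
  obtain ⟨z, hz⟩ := exists_int_add_digitTail hb ha hξ n
  rw [hz, distInt_int_add]
  rcases h with h | h
  · exact (distInt_le_self (digitTail_nonneg n)).trans (digitTail_run_zero hb ha n L h)
  · refine (distInt_le_one_sub (digitTail_le_one hb ha n)).trans ?_
    rw [← digitTail_compl hb ha]
    refine digitTail_run_zero hb (fun j => by omega) n L fun j hj hj' => ?_
    rw [h j hj hj', Nat.sub_self]

lemma IsRun.mono {n L n' L' : ℕ} (h : IsRun b a n L) (h1 : n ≤ n') (h2 : n' + L' ≤ n + L) :
    IsRun b a n' L' :=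
  h.imp (fun h j hj hj' => h j (by omega) (by omega)) fun h j hj hj' => h j (by omega) (by omega)

end Tail


/-! ### The two exponents in terms of run lengths -/

section Exponents

variable {b : ℕ} {a : ℕ → ℕ} {ξ : ℝ}

lemma pow_rpow_neg_eq (b n : ℕ) (v : ℝ) :
    ((b : ℝ) ^ n) ^ (-v) = (b : ℝ) ^ (-(v * n)) := by
  rw [← Real.rpow_natCast, ← Real.rpow_mul (by positivity)]
  ring_nf

lemma inv_pow_eq_rpow (b L : ℕ) : ((b : ℝ) ^ L)⁻¹ = (b : ℝ) ^ (-(L : ℝ)) := by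
  rw [Real.rpow_neg (by positivity), Real.rpow_natCast]

lemma IsRun.distInt_lt (hb : 2 ≤ b) (ha : ∀ j, a j ≤ b - 1)
    (hξ : HasSum (fun j : ℕ => (a j : ℝ) / (b : ℝ) ^ (j + 1)) ξ) {n L N : ℕ}
    (h : IsRun b a n L) {x : ℝ} (hx : x * N < L) :
    distInt ((b : ℝ) ^ n * ξ) < ((b : ℝ) ^ N) ^ (-x) := by
  have hb' : (1 : ℝ) < b := by exact_mod_cast hb
  refine (h.distInt_le hb ha hξ).trans_lt ?_
  rw [inv_pow_eq_rpow, pow_rpow_neg_eq]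
  exact Real.rpow_lt_rpow_of_exponent_lt hb' (by linarith)

lemma isRun_floor_of_distInt_lt (hb : 2 ≤ b) (ha : ∀ j, a j ≤ b - 1)
    (hξ : HasSum (fun j : ℕ => (a j : ℝ) / (b : ℝ) ^ (j + 1)) ξ) {n N : ℕ} {x v : ℝ}
    (hv : 0 ≤ v) (hvx : v ≤ x)
    (h : distInt ((b : ℝ) ^ n * ξ) < ((b : ℝ) ^ N) ^ (-x)) : IsRun b a n ⌊v * N⌋₊ := by
  have hb' : (1 : ℝ) ≤ b := by exact_mod_cast (by omega : 1 ≤ b)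
  refine isRun_of_distInt_lt hb ha hξ (h.trans_le ?_)
  rw [inv_pow_eq_rpow, pow_rpow_neg_eq]
  refine Real.rpow_le_rpow_of_exponent_le hb' ?_
  have h1 := Nat.floor_le (a := v * N) (by positivity)
  have h2 : v * N ≤ x * N := by gcongr
  linarith

/-- A natural number beyond which `C < t * N`. -/
lemma exists_nat_forall_lt_mul {t : ℝ} (ht : 0 < t) (C : ℝ) :
    ∃ N₀ : ℕ, ∀ N : ℕ, N₀ ≤ N → C < t * N := by
  obtain ⟨N₀, hN⟩ := exists_nat_gt (C / t)
  refine ⟨N₀, fun N hN' => ?_⟩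
  have : (N₀ : ℝ) ≤ N := by exact_mod_cast hN'
  rw [div_lt_iff₀ ht] at hN
  nlinarith

/-- The exponents ignore bounded changes of length: for `x < v` the gap `(v - x) N` eventually
exceeds any constant. Here and in the next three lemmas `C` absorbs floors, ceilings and the period
of a pattern. -/
lemma le_vHatExp_of_isRun (hb : 2 ≤ b) (ha : ∀ j, a j ≤ b - 1)
    (hξ : HasSum (fun j : ℕ => (a j : ℝ) / (b : ℝ) ^ (j + 1)) ξ) {v C : ℝ} {N₀ : ℕ}
    (h : ∀ N : ℕ, N₀ ≤ N → ∃ n L : ℕ, 1 ≤ n ∧ n ≤ N ∧ IsRun b a n L ∧ v * N - C ≤ L) :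
    (v : EReal) ≤ vHatExp b ξ := by
  by_contra! hlt
  obtain ⟨x, hx1, hx2⟩ := EReal.lt_iff_exists_real_btwn.1 hlt
  have hxv : x < v := by exact_mod_cast hx2
  refine hx1.not_ge (le_sSup ⟨x, ?_, rfl⟩)
  obtain ⟨N₁, hN₁⟩ := exists_nat_forall_lt_mul (sub_pos.2 hxv) C
  refine ⟨max N₀ N₁, fun N hN => ?_⟩
  obtain ⟨n, L, h1, h2, h3, h4⟩ := h N (le_of_max_le_left hN)
  refine ⟨n, h1, h2, h3.distInt_lt hb ha hξ ?_⟩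
  have := hN₁ N (le_of_max_le_right hN)
  linarith

lemma le_vExp_of_isRun (hb : 2 ≤ b) (ha : ∀ j, a j ≤ b - 1)
    (hξ : HasSum (fun j : ℕ => (a j : ℝ) / (b : ℝ) ^ (j + 1)) ξ) {v C : ℝ}
    (h : ∀ N₀ : ℕ, ∃ n L : ℕ, N₀ ≤ n ∧ IsRun b a n L ∧ v * n - C ≤ L) :
    (v : EReal) ≤ vExp b ξ := by
  by_contra! hlt
  obtain ⟨x, hx1, hx2⟩ := EReal.lt_iff_exists_real_btwn.1 hlt
  have hxv : x < v := by exact_mod_cast hx2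
  refine hx1.not_ge (le_sSup ⟨x, ?_, rfl⟩)
  obtain ⟨N₁, hN₁⟩ := exists_nat_forall_lt_mul (sub_pos.2 hxv) C
  refine Set.infinite_of_forall_exists_gt fun m => ?_
  obtain ⟨n, L, h1, h3, h4⟩ := h (max (m + 1) N₁)
  have h5 := le_of_max_le_left h1
  refine ⟨n, ⟨by omega, h3.distInt_lt hb ha hξ ?_⟩, by omega⟩
  have := hN₁ n (le_of_max_le_right h1)
  linarith

lemma vHatExp_le_of_isRun (hb : 2 ≤ b) (ha : ∀ j, a j ≤ b - 1)
    (hξ : HasSum (fun j : ℕ => (a j : ℝ) / (b : ℝ) ^ (j + 1)) ξ) {v C : ℝ} (hv : 0 ≤ v)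
    (h : ∀ N₀ : ℕ, ∃ N : ℕ, N₀ ≤ N ∧ ∀ n L : ℕ, n ≤ N → IsRun b a n L → (L : ℝ) ≤ v * N + C) :
    vHatExp b ξ ≤ v := by
  refine sSup_le ?_
  rintro _ ⟨x, ⟨N₀, hx⟩, rfl⟩
  refine EReal.coe_le_coe_iff.2 (le_of_not_gt fun hlt => ?_)
  obtain ⟨N₁, hN₁⟩ := exists_nat_forall_lt_mul (sub_pos.2 hlt) (C + 1)
  obtain ⟨N, hN, hrun⟩ := h (max N₀ N₁)
  obtain ⟨n, -, h2, h3⟩ := hx N (le_of_max_le_left hN)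
  have h4 := hrun n _ h2
    (isRun_floor_of_distInt_lt hb ha hξ (hv.trans hlt.le) le_rfl h3)
  have h5 := Nat.lt_floor_add_one (x * N)
  have := hN₁ N (le_of_max_le_right hN)
  linarith

lemma vExp_le_of_isRun (hb : 2 ≤ b) (ha : ∀ j, a j ≤ b - 1)
    (hξ : HasSum (fun j : ℕ => (a j : ℝ) / (b : ℝ) ^ (j + 1)) ξ) {v C : ℝ} (hv : 0 ≤ v)
    (h : ∀ n L : ℕ, IsRun b a n L → (L : ℝ) ≤ v * n + C) :
    vExp b ξ ≤ v := by
  refine sSup_le ?_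
  rintro _ ⟨x, hx, rfl⟩
  refine EReal.coe_le_coe_iff.2 (le_of_not_gt fun hlt => ?_)
  obtain ⟨N₁, hN₁⟩ := exists_nat_forall_lt_mul (sub_pos.2 hlt) (C + 1)
  obtain ⟨n, ⟨-, h3⟩, hn⟩ := hx.exists_gt N₁
  have h4 := h n _ (isRun_floor_of_distInt_lt hb ha hξ (hv.trans hlt.le) le_rfl h3)
  have h5 := Nat.lt_floor_add_one (x * n)
  have := hN₁ n hn.le
  linarith

lemma exists_isRun_of_lt_vHatExp (hb : 2 ≤ b) (ha : ∀ j, a j ≤ b - 1)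
    (hξ : HasSum (fun j : ℕ => (a j : ℝ) / (b : ℝ) ^ (j + 1)) ξ) {v : ℝ} (hv : 0 ≤ v)
    (h : (v : EReal) < vHatExp b ξ) :
    ∃ N₀ : ℕ, ∀ N : ℕ, N₀ ≤ N → ∃ n : ℕ, n ≤ N ∧ IsRun b a n ⌊v * N⌋₊ := by
  obtain ⟨_, ⟨x, ⟨N₀, hx⟩, rfl⟩, hvx⟩ := lt_sSup_iff.1 h
  have hvx : v < x := EReal.coe_lt_coe_iff.1 hvx
  refine ⟨N₀, fun N hN => ?_⟩
  obtain ⟨n, -, h2, h3⟩ := hx N hN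
  exact ⟨n, h2, isRun_floor_of_distInt_lt hb ha hξ hv hvx.le h3⟩

lemma exists_isRun_of_lt_vExp (hb : 2 ≤ b) (ha : ∀ j, a j ≤ b - 1)
    (hξ : HasSum (fun j : ℕ => (a j : ℝ) / (b : ℝ) ^ (j + 1)) ξ) {v : ℝ} (hv : 0 ≤ v)
    (h : (v : EReal) < vExp b ξ) (N₀ : ℕ) :
    ∃ n : ℕ, N₀ ≤ n ∧ IsRun b a n ⌊v * n⌋₊ := by
  obtain ⟨_, ⟨x, hx, rfl⟩, hvx⟩ := lt_sSup_iff.1 h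
  have hvx : v < x := EReal.coe_lt_coe_iff.1 hvx
  obtain ⟨n, ⟨-, h3⟩, hn⟩ := Set.Infinite.exists_gt hx N₀
  exact ⟨n, hn.le, isRun_floor_of_distInt_lt hb ha hξ hv hvx.le h3⟩

lemma vHatExp_nonneg (b : ℕ) (ξ : ℝ) (hb : 2 ≤ b) : 0 ≤ vHatExp b ξ := by
  by_contra! hlt
  obtain ⟨x, hx1, hx2⟩ := EReal.lt_iff_exists_real_btwn.1 hlt
  have hxv : x < 0 := by exact_mod_cast hx2
  refine hx1.not_ge (le_sSup ⟨x, ⟨1, fun N hN => ⟨1, le_rfl, hN, ?_⟩⟩, rfl⟩)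
  refine (distInt_le_half _).trans_lt (lt_of_lt_of_le (by norm_num) (b := 1) ?_)
  exact Real.one_le_rpow (one_le_pow₀ (by exact_mod_cast (by omega : 1 ≤ b))) (by linarith)

lemma vExp_nonneg (b : ℕ) (ξ : ℝ) (hb : 2 ≤ b) : 0 ≤ vExp b ξ := by
  by_contra! hlt
  obtain ⟨x, hx1, hx2⟩ := EReal.lt_iff_exists_real_btwn.1 hlt
  have hxv : x < 0 := by exact_mod_cast hx2
  refine hx1.not_ge (le_sSup ⟨x, ?_, rfl⟩)
  refine Set.infinite_of_forall_exists_gt fun m => ⟨m + 1, ⟨by omega, ?_⟩, by omega⟩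
  refine (distInt_le_half _).trans_lt (lt_of_lt_of_le (by norm_num) (b := 1) ?_)
  exact Real.one_le_rpow (one_le_pow₀ (by exact_mod_cast (by omega : 1 ≤ b))) (by linarith)

lemma exists_isRun_length_le_of_distInt_ne_zero (hb : 2 ≤ b) (ha : ∀ j, a j ≤ b - 1)
    (hξ : HasSum (fun j : ℕ => (a j : ℝ) / (b : ℝ) ^ (j + 1)) ξ) {n : ℕ}
    (hn : distInt ((b : ℝ) ^ n * ξ) ≠ 0) : ∃ M : ℕ, ∀ L, IsRun b a n L → L ≤ M := by
  have hb' : (1 : ℝ) < b := by exact_mod_cast hb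
  obtain ⟨M, hM⟩ := exists_pow_lt_of_lt_one
    (lt_of_le_of_ne (distInt_nonneg _) hn.symm) (inv_lt_one_of_one_lt₀ hb')
  refine ⟨M, fun L hL => le_of_not_gt fun hlt => ?_⟩
  have h := (hL.mono le_rfl (show n + M ≤ n + L by omega)).distInt_le hb ha hξ
  rw [inv_pow] at hM
  exact hM.not_ge h

/-- Only finitely many `n` violate the bound `w * n`, and at each of them the run is finite because
`b ^ n ξ` is not an integer; `M` sums these exceptional lengths. -/
lemma exists_isRun_length_le_of_vExp_lt (hb : 2 ≤ b) (ha : ∀ j, a j ≤ b - 1)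
    (hξ : HasSum (fun j : ℕ => (a j : ℝ) / (b : ℝ) ^ (j + 1)) ξ)
    (hne : ∀ n : ℕ, distInt ((b : ℝ) ^ n * ξ) ≠ 0) {w : ℝ} (hw : 0 ≤ w)
    (h : vExp b ξ < w) : ∃ M : ℕ, ∀ n L : ℕ, IsRun b a n L → (L : ℝ) ≤ w * n + M := by
  have hb' : (1 : ℝ) < b := by exact_mod_cast hb
  have hfin : {n : ℕ | 0 < n ∧ distInt ((b : ℝ) ^ n * ξ) < ((b : ℝ) ^ n) ^ (-w)}.Finite := by
    by_contra hinf
    exact h.not_ge (le_sSup ⟨w, hinf, rfl⟩)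
  obtain ⟨n₀, hn₀⟩ := hfin.bddAbove
  choose M hM using fun n => exists_isRun_length_le_of_distInt_ne_zero hb ha hξ (hne n)
  refine ⟨∑ n ∈ Finset.range (n₀ + 1), M n, fun n L hL => ?_⟩
  by_cases hn : n ≤ n₀
  · have h1 := hM n L hL
    have h2 : M n ≤ ∑ n ∈ Finset.range (n₀ + 1), M n :=
      Finset.single_le_sum (fun _ _ => Nat.zero_le _) (Finset.mem_range.2 (by omega))
    have h3 : (L : ℝ) ≤ (∑ n ∈ Finset.range (n₀ + 1), M n : ℕ) := by exact_mod_cast h1.trans h2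
    have : 0 ≤ w * n := by positivity
    linarith
  · have h1 : L ≤ w * n := by
      by_contra! hlt
      exact hn (hn₀ ⟨by omega, hL.distInt_lt hb ha hξ hlt⟩)
    have : (0 : ℝ) ≤ (∑ n ∈ Finset.range (n₀ + 1), M n : ℕ) := by positivity
    linarith

/-- A run beginning at `n ≤ N` has length at most `w n + M ≤ w N + M`, too short for a uniform
exponent above `w`. -/
lemma vHatExp_le_vExp (hb : 2 ≤ b) (ha : ∀ j, a j ≤ b - 1)
    (hξ : HasSum (fun j : ℕ => (a j : ℝ) / (b : ℝ) ^ (j + 1)) ξ)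
    (hne : ∀ n : ℕ, distInt ((b : ℝ) ^ n * ξ) ≠ 0) : vHatExp b ξ ≤ vExp b ξ := by
  by_contra! hlt
  obtain ⟨v, hv1, hv2⟩ := EReal.lt_iff_exists_real_btwn.1 hlt
  obtain ⟨w, hw1, hw2⟩ := EReal.lt_iff_exists_real_btwn.1 hv1
  have hw0 : 0 ≤ w := by exact_mod_cast ((vExp_nonneg b ξ hb).trans hw1.le)
  have hwv : w < v := by exact_mod_cast hw2
  obtain ⟨M, hM⟩ := exists_isRun_length_le_of_vExp_lt hb ha hξ hne hw0 hw1
  obtain ⟨N₀, hN₀⟩ := exists_isRun_of_lt_vHatExp hb ha hξ (hw0.trans hwv.le) hv2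
  obtain ⟨N₁, hN₁⟩ := exists_nat_forall_lt_mul (sub_pos.2 hwv) (M + 1)
  obtain ⟨n, hn, hrun⟩ := hN₀ (max N₀ N₁) (le_max_left _ _)
  have h1 := hM _ _ hrun
  have h2 := hN₁ (max N₀ N₁) (le_max_right _ _)
  have h3 := Nat.lt_floor_add_one (v * (max N₀ N₁ : ℕ))
  have h4 : w * n ≤ w * (max N₀ N₁ : ℕ) := by gcongr
  linarith

end Exponents


/-! ### Counting the words that end before a start -/

/-- The word formed by the first `n` digits of `a`, extended by zeros. -/
def trunc (n : ℕ) (a : ℕ → ℕ) : ℕ → ℕ := fun j => if j < n then a j else 0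

open scoped Classical in
/-- All the ways to change the words of `T` at the positions `m, …, m + k - 1`
by digits from `S`. -/
noncomputable def extendWords (S : Finset ℕ) (T : Finset (ℕ → ℕ)) (m : ℕ) : ℕ → Finset (ℕ → ℕ)
  | 0 => T
  | k + 1 => Finset.image₂ (fun p d => Function.update p (m + k) d) (extendWords S T m k) S

lemma card_extendWords_le (S : Finset ℕ) (T : Finset (ℕ → ℕ)) (m k : ℕ) :
    (extendWords S T m k).card ≤ T.card * S.card ^ k := by
  classical
  induction k with
  | zero => simp [extendWords]
  | succ k ih =>
    refine (Finset.card_image₂_le _ _ _).trans ?_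
    rw [pow_succ, ← mul_assoc]
    exact Nat.mul_le_mul_right _ ih

lemma trunc_mem_extendWords {S : Finset ℕ} {T : Finset (ℕ → ℕ)} {m : ℕ} {a : ℕ → ℕ}
    (ha : ∀ j, a j ∈ S) (h : trunc m a ∈ T) (k : ℕ) :
    trunc (m + k) a ∈ extendWords S T m k := by
  classical
  induction k with
  | zero => exact h
  | succ k ih =>
    refine Finset.mem_image₂.2 ⟨_, ih, _, ha (m + k), ?_⟩
    funext j
    by_cases hj : j = m + k
    · subst hj
      simp [trunc]
    · rw [Function.update_of_ne hj]
      simp only [trunc]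
      congr 1
      simp only [eq_iff_iff]
      omega

/-- The set of all words of length `n` with digits in `S`. -/
noncomputable def allWords (S : Finset ℕ) (n : ℕ) : Finset (ℕ → ℕ) := extendWords S {fun _ => 0} 0 n

lemma card_allWords_le (S : Finset ℕ) (n : ℕ) : (allWords S n).card ≤ S.card ^ n := by
  simpa [allWords] using card_extendWords_le S {fun _ => 0} 0 n

lemma trunc_mem_allWords {S : Finset ℕ} {a : ℕ → ℕ} (ha : ∀ j, a j ∈ S) (n : ℕ) :
    trunc n a ∈ allWords S n := by
  have := trunc_mem_extendWords (T := {fun _ => 0}) (m := 0) ha 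
    (Finset.mem_singleton.2 (funext fun j => by simp [trunc])) n
  simpa [allWords] using this

/-- Overwrite the positions `m, …, m + L - 1` of a word by the digit `z`. -/
def fillWord (z m L : ℕ) (p : ℕ → ℕ) : ℕ → ℕ := fun j => if m ≤ j ∧ j < m + L then z else p j

lemma trunc_add_eq_fillWord {a : ℕ → ℕ} {z m L : ℕ} (h : ∀ j, m ≤ j → j < m + L → a j = z) :
    trunc (m + L) a = fillWord z m L (trunc m a) := by
  funext j
  simp only [trunc, fillWord]
  by_cases h1 : m ≤ j ∧ j < m + L
  · rw [if_pos h1.2, if_pos h1, h j h1.1 h1.2]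
  · rw [if_neg h1]
    congr 1
    simp only [eq_iff_iff]
    omega

/-- The digit at position `n` differs from the one before it. -/
def IsStart (a : ℕ → ℕ) (n : ℕ) : Prop := 1 ≤ n ∧ a (n - 1) ≠ a n

/-- A constant block can be extended to the left up to position `0` or to a start. -/
lemma exists_isStart_of_const {a : ℕ → ℕ} {z n m : ℕ} (hnm : n < m)
    (h : ∀ j, n ≤ j → j < m → a j = z) :
    ∃ n' ≤ n, (n' = 0 ∨ IsStart a n') ∧ ∀ j, n' ≤ j → j < m → a j = z := by
  induction n with
  | zero => exact ⟨0, le_rfl, Or.inl rfl, h⟩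
  | succ n ih =>
    by_cases hz : a n = z
    · obtain ⟨n', h1, h2, h3⟩ := ih (by omega) fun j hj hj' => by
        rcases hj.eq_or_lt with rfl | hj
        · exact hz
        · exact h j hj hj'
      exact ⟨n', by omega, h2, h3⟩
    · refine ⟨n + 1, le_rfl, Or.inr ⟨by omega, ?_⟩, h⟩
      rw [h (n + 1) le_rfl hnm]
      simpa using hz

/-- Digit sequences in `S` all of whose runs satisfy the bounds attached to a uniform exponent
larger than `v` and an exponent smaller than `w`, with thresholds given by `M`. -/
structure RunBounds (b : ℕ) (S : Finset ℕ) (v w : ℝ) (M : ℕ) (a : ℕ → ℕ) : Prop where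
  mem : ∀ j, a j ∈ S
  exists_run : ∀ N : ℕ, M ≤ N → ∃ n : ℕ, n ≤ N ∧ IsRun b a n ⌊v * N⌋₊
  length_le : ∀ n L : ℕ, IsRun b a n L → (L : ℝ) ≤ w * n + M

/-- The last complete long run before a start `n`. -/
lemma RunBounds.exists_prev_start {b : ℕ} {S : Finset ℕ} {v w : ℝ} {M : ℕ} {a : ℕ → ℕ}
    (h : RunBounds b S v w M a) {n : ℕ} (hn : IsStart a n) (hM : M ≤ n - 1)
    (hL : M < ⌊v * (n - 1 : ℕ)⌋₊) :
    ∃ n' z : ℕ, IsStart a n' ∧ n' < n ∧ n' + ⌊v * (n - 1 : ℕ)⌋₊ ≤ n ∧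
      ((⌊v * (n - 1 : ℕ)⌋₊ : ℕ) : ℝ) ≤ w * n' + M ∧ (z = 0 ∨ z = b - 1) ∧
      ∀ j, n' ≤ j → j < n' + ⌊v * (n - 1 : ℕ)⌋₊ → a j = z := by
  set L := ⌊v * (n - 1 : ℕ)⌋₊ with hLdef
  obtain ⟨m, hm, hrun⟩ := h.exists_run (n - 1) hM
  obtain ⟨z, hz, hrun⟩ : ∃ z, (z = 0 ∨ z = b - 1) ∧ ∀ j, m ≤ j → j < m + L → a j = z := by
    rcases hrun with hrun | hrun
    · exact ⟨0, Or.inl rfl, hrun⟩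
    · exact ⟨b - 1, Or.inr rfl, hrun⟩
  have hn1 := hn.1
  -- The run begins by `n - 1` and cannot contain both `n - 1` and `n`, since the digit changes
  -- there.
  have hmn : m + L ≤ n := by
    by_contra! hlt
    exact hn.2 (by rw [hrun (n - 1) hm (by omega), hrun n (by omega) hlt])
  obtain ⟨n', h1, h2, h3⟩ := exists_isStart_of_const (by omega) hrun
  have hlen : (L : ℝ) ≤ w * n' + M := by
    refine h.length_le n' L ?_
    rcases hz with rfl | rfl
    · exact Or.inl fun j hj hj' => h3 j hj (by omega)
    · exact Or.inr fun j hj hj' => h3 j hj (by omega)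
  -- A run beginning at `0` has length at most `M < L`, so the left end is a genuine start.
  have h0 : n' ≠ 0 := by
    rintro rfl
    have : (L : ℝ) ≤ M := by simpa using hlen
    have : L ≤ M := by exact_mod_cast this
    omega
  exact ⟨n', z, h2.resolve_left h0, by omega, by omega, hlen, hz,
    fun j hj hj' => h3 j hj (by omega)⟩

open scoped Classical in
/-- The possible words of length `n` ending before a start, built from the shorter ones. -/
noncomputable def startWords (b : ℕ) (S : Finset ℕ) (w : ℝ) (M L n : ℕ)
    (T : ℕ → Finset (ℕ → ℕ)) : Finset (ℕ → ℕ) :=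
  ((Finset.range n).filter fun m => m + L ≤ n ∧ (L : ℝ) ≤ w * m + M).biUnion fun m =>
    ({0, b - 1} : Finset ℕ).biUnion fun z =>
      extendWords S ((T m).image (fillWord z m L)) (m + L) (n - (m + L))

lemma card_startWords_le (b : ℕ) (S : Finset ℕ) (w : ℝ) (M L n : ℕ)
    (T : ℕ → Finset (ℕ → ℕ)) {D : ℝ} (hD0 : 0 ≤ D)
    (hD : ∀ m < n, m + L ≤ n → (L : ℝ) ≤ w * m + M →
      ((T m).card : ℝ) * (S.card : ℝ) ^ (n - (m + L)) ≤ D) :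
    ((startWords b S w M L n T).card : ℝ) ≤ n * (2 * D) := by
  classical
  have h1 : ((startWords b S w M L n T).card : ℝ) ≤
      ∑ m ∈ (Finset.range n).filter fun m => m + L ≤ n ∧ (L : ℝ) ≤ w * m + M, 2 * D := by
    unfold startWords
    refine (Nat.cast_le.2 (Finset.card_biUnion_le (M := ℕ → ℕ))).trans ?_
    rw [Nat.cast_sum]
    refine Finset.sum_le_sum fun m hm => ?_
    simp only [Finset.mem_filter, Finset.mem_range] at hm
    refine (Nat.cast_le.2 (Finset.card_biUnion_le (M := ℕ → ℕ))).trans ?_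
    rw [Nat.cast_sum]
    have h2 : ∑ z ∈ ({0, b - 1} : Finset ℕ),
        ((extendWords S ((T m).image (fillWord z m L)) (m + L) (n - (m + L))).card : ℝ) ≤
        ∑ z ∈ ({0, b - 1} : Finset ℕ), D := by
      refine Finset.sum_le_sum fun z _ => ?_
      refine le_trans ?_ (hD m hm.1 hm.2.1 hm.2.2)
      refine (Nat.cast_le.2 (card_extendWords_le _ _ _ _)).trans ?_
      push_cast
      exact mul_le_mul_of_nonneg_right (Nat.cast_le.2 Finset.card_image_le) (by positivity)
    refine h2.trans ?_
    rw [Finset.sum_const, nsmul_eq_mul]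
    gcongr
    exact_mod_cast (Finset.card_le_two : ({0, b - 1} : Finset ℕ).card ≤ 2)
  refine h1.trans ?_
  rw [Finset.sum_const, nsmul_eq_mul]
  gcongr
  exact_mod_cast (Finset.card_filter_le _ _).trans (by simp)

lemma RunBounds.trunc_mem_startWords {b : ℕ} {S : Finset ℕ} {v w : ℝ} {M : ℕ} {a : ℕ → ℕ}
    (h : RunBounds b S v w M a) {n : ℕ} (hn : IsStart a n) (hM : M ≤ n - 1)
    (hL : M < ⌊v * (n - 1 : ℕ)⌋₊) {T : ℕ → Finset (ℕ → ℕ)}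
    (hT : ∀ m < n, IsStart a m → trunc m a ∈ T m) :
    trunc n a ∈ startWords b S w M ⌊v * (n - 1 : ℕ)⌋₊ n T := by
  classical
  obtain ⟨m, z, h1, h2, h3, h4, h5, h6⟩ := h.exists_prev_start hn hM hL
  refine Finset.mem_biUnion.2 ⟨m, by simp [h2, h3, h4], Finset.mem_biUnion.2 ⟨z, by simpa, ?_⟩⟩
  have := trunc_mem_extendWords (T := (T m).image (fillWord z m ⌊v * (n - 1 : ℕ)⌋₊)) h.mem
    (Finset.mem_image.2 ⟨_, hT m h2 h1, (trunc_add_eq_fillWord h6).symm⟩)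
    (n - (m + ⌊v * (n - 1 : ℕ)⌋₊))
  rwa [Nat.add_sub_cancel' h3] at this

/-- The exponent estimate behind the inductive count of words. -/
lemma word_exponent_le {v w β n m L M : ℝ} (hv : 0 < v) (hvw : v < w) (hβ1 : β ≤ 1)
    (h1 : L ≤ w * m + M) (h2 : v * (n - 1) - 1 ≤ L) :
    β * m + (n - (m + L)) ≤
      (1 - v * (1 + (1 - β) / w)) * n +
        ((1 + (1 - β) / w) * (v + 1) + (1 - β) / w * M) := by
  have hw : 0 < w := hv.trans hvw
  have hc : 0 ≤ (1 - β) / w := div_nonneg (by linarith) hw.le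
  have e : 1 - β = (1 - β) / w * w := by field_simp
  set c := (1 - β) / w with hcdef
  have h3 : c * (L - M) ≤ c * (w * m) := mul_le_mul_of_nonneg_left (by linarith) hc
  have h4 : (1 + c) * (v * (n - 1) - 1) ≤ (1 + c) * L :=
    mul_le_mul_of_nonneg_left h2 (by linarith)
  have h5 : (1 - β) * m = c * (w * m) := by rw [e]; ring
  nlinarith

/-- The recursion over the previous start turns the rate `β` into `1 - v (1 + (1 - β) / w)`, whose
fixed point is `1 - v w / (w - v)`. Above the fixed point the new rate is smaller by some `γ > 0`,
and `s ^ (-γ n)` outweighs the factor `2 n` for the choice of the previous start and of the digit.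
-/
lemma exists_startWords_count (b : ℕ) {S : Finset ℕ} (hS : 2 ≤ S.card) {v w β : ℝ} (hv : 0 < v)
    (hvw : v < w) (hβ : 1 - v * w / (w - v) < β) (hβ1 : β ≤ 1) (M : ℕ) :
    ∃ (C : ℝ) (T : ℕ → Finset (ℕ → ℕ)), 0 ≤ C ∧
      (∀ n : ℕ, ((T n).card : ℝ) ≤ C * (S.card : ℝ) ^ (β * n)) ∧
      ∀ a, RunBounds b S v w M a → ∀ n, IsStart a n → trunc n a ∈ T n := by
  have hw : 0 < w := hv.trans hvw
  set s : ℝ := (S.card : ℝ) with hs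
  have hs1 : 1 < s := by rw [hs]; exact_mod_cast hS
  have hs0 : 0 < s := by linarith
  set κ : ℝ := 1 + (1 - β) / w with hκ
  set K : ℝ := κ * (v + 1) + (1 - β) / w * M with hK
  have hγ : 0 < β - (1 - v * κ) := by
    have hd : 0 < w - v := by linarith
    have h1 : (1 - β) * (w - v) < v * w := by
      rw [← lt_div_iff₀ hd]
      linarith
    have h2 : v * κ - (1 - β) = (v * w - (1 - β) * (w - v)) / w := by
      rw [hκ]
      field_simp
      ring
    have h3 : 0 < (v * w - (1 - β) * (w - v)) / w := div_pos (by linarith) hw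
    linarith
  set γ := β - (1 - v * κ) with hγdef
  obtain ⟨n₁, hn₁⟩ : ∃ n₁ : ℕ, ∀ n : ℕ, n₁ ≤ n → (n : ℝ) * (2 * s ^ (K - γ * n)) ≤ 1 := by
    have hr : s ^ (-γ) < 1 := Real.rpow_lt_one_of_one_lt_of_neg hs1 (by linarith)
    have h1 := (tendsto_self_mul_const_pow_of_lt_one (by positivity) hr).const_mul (2 * s ^ K)
    rw [mul_zero] at h1
    obtain ⟨n₁, hn₁⟩ := eventually_atTop.1 (h1.eventually_le_const (zero_lt_one' ℝ))
    refine ⟨n₁, fun n hn => le_of_eq_of_le ?_ (hn₁ n hn)⟩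
    rw [← Real.rpow_natCast, ← Real.rpow_mul hs0.le, sub_eq_add_neg, Real.rpow_add hs0]
    ring_nf
  obtain ⟨n₂, hn₂⟩ := exists_nat_forall_lt_mul hv (M + 2 + v)
  set n₀ := max n₁ (max n₂ (M + 1)) with hn₀
  -- For `n < n₀` the trivial count `s ^ n` is at most `C * s ^ (β * n)`.
  set C : ℝ := s ^ ((1 - β) * n₀) with hC
  have key : ∀ n : ℕ, ∃ T : Finset (ℕ → ℕ), (T.card : ℝ) ≤ C * s ^ (β * n) ∧
      ∀ a, RunBounds b S v w M a → IsStart a n → trunc n a ∈ T := by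
    intro n
    induction n using Nat.strong_induction_on with
    | _ n ih =>
    by_cases hn : n < n₀
    · refine ⟨allWords S n, ?_, fun a ha _ => trunc_mem_allWords ha.mem n⟩
      refine (Nat.cast_le.2 (card_allWords_le S n)).trans ?_
      rw [Nat.cast_pow, hC, ← Real.rpow_add hs0, ← Real.rpow_natCast]
      refine Real.rpow_le_rpow_of_exponent_le hs1.le ?_
      have : (n : ℝ) ≤ n₀ := by exact_mod_cast hn.le
      nlinarith
    · push Not at hn
      have hnn₁ : n₁ ≤ n := (le_max_left _ _).trans hn
      have hnn₂ : n₂ ≤ n := (le_max_left _ _).trans ((le_max_right _ _).trans hn)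
      have hnM : M + 1 ≤ n := (le_max_right _ _).trans ((le_max_right _ _).trans hn)
      choose! T hT1 hT2 using ih
      have hfl := Nat.lt_floor_add_one (v * (n - 1 : ℕ))
      set L := ⌊v * (n - 1 : ℕ)⌋₊ with hL
      rw [Nat.cast_sub (by omega), Nat.cast_one] at hfl
      have hLM : M < L := by
        have := hn₂ n hnn₂
        have : (M : ℝ) < L := by linarith
        exact_mod_cast this
      refine ⟨startWords b S w M L n T, ?_, fun a ha hst =>
        ha.trunc_mem_startWords hst (by omega) hLM fun m hm hm' => hT2 m hm a ha hm'⟩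
      refine (card_startWords_le b S w M L n T (D := C * s ^ (β * n + (K - γ * n)))
        (by positivity) fun m hm hmL hlen => ?_).trans ?_
      · refine (mul_le_mul_of_nonneg_right (hT1 m hm) (by positivity)).trans ?_
        rw [mul_assoc, ← hs, ← Real.rpow_natCast s, ← Real.rpow_add hs0]
        refine mul_le_mul_of_nonneg_left ?_ (by positivity)
        refine Real.rpow_le_rpow_of_exponent_le hs1.le ?_
        rw [Nat.cast_sub hmL, Nat.cast_add]
        have := word_exponent_le hv hvw hβ1 hlen (by linarith : v * ((n : ℝ) - 1) - 1 ≤ L)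
        rw [← hκ, ← hK] at this
        rw [hγdef]
        linarith
      · have := hn₁ n hnn₁
        rw [Real.rpow_add hs0]
        calc (n : ℝ) * (2 * (C * (s ^ (β * n) * s ^ (K - γ * n))))
            = C * s ^ (β * n) * (n * (2 * s ^ (K - γ * n))) := by ring
          _ ≤ C * s ^ (β * n) * 1 := by gcongr
          _ = _ := mul_one _
  choose T hT1 hT2 using key
  exact ⟨C, T, by positivity, hT1, fun a ha n hn => hT2 n a ha hn⟩


/-! ### Coverings by cylinders with a prescribed run -/

section Cover

variable {b : ℕ}

lemma abs_digitTail_sub_le (hb : 2 ≤ b) {a a' : ℕ → ℕ} (ha : ∀ j, a j ≤ b - 1)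
    (ha' : ∀ j, a' j ≤ b - 1) (n L : ℕ) (h : ∀ j, n ≤ j → j < n + L → a j = a' j) :
    |digitTail b a n - digitTail b a' n| ≤ ((b : ℝ) ^ L)⁻¹ := by
  induction L generalizing n with
  | zero =>
    have h1 := digitTail_le_one hb ha n
    have h2 := digitTail_le_one hb ha' n
    have h3 := digitTail_nonneg (b := b) (a := a) n
    have h4 := digitTail_nonneg (b := b) (a := a') n
    rw [pow_zero, inv_one, abs_le]
    constructor <;> linarith
  | succ L ih =>
    have hb' : (0 : ℝ) < b := by positivity
    have h1 := ih (n + 1) fun j hj hj' => h j (by omega) (by omega)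
    have h2 := digitTail_succ hb ha n
    have h3 := digitTail_succ hb ha' n
    rw [h n le_rfl (by omega)] at h2
    rw [pow_succ, mul_inv, ← div_eq_mul_inv, le_div_iff₀ hb', ← abs_of_pos hb', ← abs_mul,
      abs_of_pos hb', mul_comm, mul_sub, h2, h3]
    simpa using h1

/-- The reals with a digit expansion that starts with the word `p` of length `n`, followed by
`L` digits all equal to `b - 1` or `0`, according to `z`. -/
def runCylinder (b n L : ℕ) (p : ℕ → ℕ) (z : Bool) : Set ℝ :=
  {ξ | ∃ a : ℕ → ℕ, (∀ j, a j ≤ b - 1) ∧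
    HasSum (fun j : ℕ => (a j : ℝ) / (b : ℝ) ^ (j + 1)) ξ ∧ trunc n a = p ∧
    ∀ j, n ≤ j → j < n + L → a j = if z then b - 1 else 0}

lemma ediam_runCylinder_le (hb : 2 ≤ b) (n L : ℕ) (p : ℕ → ℕ) (z : Bool) :
    Metric.ediam (runCylinder b n L p z) ≤ ENNReal.ofReal (((b : ℝ) ^ (n + L))⁻¹) := by
  refine Metric.ediam_le ?_
  rintro ξ ⟨a, ha, hξ, hp, hz⟩ ξ' ⟨a', ha', hξ', hp', hz'⟩
  rw [edist_dist, Real.dist_eq]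
  refine ENNReal.ofReal_le_ofReal ?_
  have h := abs_digitTail_sub_le hb ha ha' 0 (n + L) fun j _ hj => by
    by_cases hjn : j < n
    · have := congrFun (hp.trans hp'.symm) j
      simpa [trunc, hjn] using this
    · rw [hz j (by omega) (by omega), hz' j (by omega) (by omega)]
  simpa [digitTail, hξ.tsum_eq, hξ'.tsum_eq] using h

/-- Every point lies in cylinders of arbitrarily large level, so those of level at least `N` cover
`E`. Their total `d`-dimensional size is the tail of a convergent geometric series, whence the
Hausdorff measure vanishes. -/
lemma dimH_le_of_forall_cover (hb : 2 ≤ b) {d K ρ : ℝ} (hd : 0 < d) (hK : 0 ≤ K) (hρ0 : 0 ≤ ρ)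
    (hρ1 : ρ < 1) (L : ℕ → ℕ) (T : ℕ → Finset (ℕ → ℕ))
    (hT : ∀ n, ((T n).card : ℝ) * (((b : ℝ) ^ (n + L n))⁻¹) ^ d ≤ K * ρ ^ n) {E : Set ℝ}
    (hE : ∀ ξ ∈ E, ∃ a : ℕ → ℕ, (∀ j, a j ≤ b - 1) ∧
      HasSum (fun j : ℕ => (a j : ℝ) / (b : ℝ) ^ (j + 1)) ξ ∧
      ∀ N : ℕ, ∃ n : ℕ, N ≤ n ∧ trunc n a ∈ T n ∧ IsRun b a n (L n)) :
    dimH E ≤ ENNReal.ofReal d := by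
  have hb' : (1 : ℝ) < b := by exact_mod_cast hb
  have hb0 : (0 : ℝ) < b := by linarith
  have hzero : μH[d] E = 0 := by
    have hr : Tendsto (fun N : ℕ => ENNReal.ofReal ((b : ℝ)⁻¹ ^ N)) atTop (𝓝 0) := by
      have := ENNReal.tendsto_ofReal (tendsto_pow_atTop_nhds_zero_of_lt_one
        (by positivity) (inv_lt_one_of_one_lt₀ hb'))
      rwa [ENNReal.ofReal_zero] at this
    refine le_antisymm ((Measure.hausdorffMeasure_le_liminf_tsum
      (ι := fun N : ℕ => Σ n : ℕ, (T (N + n) : Finset (ℕ → ℕ)) × Bool) d E _ hr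
      (fun N i => runCylinder b (N + i.1) (L (N + i.1)) i.2.1 i.2.2)
      (Eventually.of_forall fun N i => ?_) (Eventually.of_forall fun N => ?_)).trans ?_) zero_le
    · refine (ediam_runCylinder_le hb _ _ _ _).trans (ENNReal.ofReal_le_ofReal ?_)
      rw [inv_pow]
      gcongr
      · exact hb'.le
      · omega
    · intro ξ hξ
      obtain ⟨a, ha, hsum, hinf⟩ := hE ξ hξ
      obtain ⟨n, hn, hmem, hrun⟩ := hinf N
      obtain ⟨k, rfl⟩ := Nat.exists_eq_add_of_le hn
      rw [Set.mem_iUnion]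
      rcases hrun with hrun | hrun
      · exact ⟨⟨k, ⟨_, hmem⟩, false⟩, a, ha, hsum, rfl, by simpa using hrun⟩
      · exact ⟨⟨k, ⟨_, hmem⟩, true⟩, a, ha, hsum, rfl, by simpa using hrun⟩
    · have hbound : ∀ N : ℕ, ∑' i : (Σ n : ℕ, (T (N + n) : Finset (ℕ → ℕ)) × Bool),
          Metric.ediam (runCylinder b (N + i.1) (L (N + i.1)) i.2.1 i.2.2) ^ d ≤
          ENNReal.ofReal (2 * K / (1 - ρ) * ρ ^ N) := by
        intro N
        rw [ENNReal.tsum_sigma']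
        have h1 : ∀ n : ℕ, ∑' i : (T (N + n) : Finset (ℕ → ℕ)) × Bool,
            Metric.ediam (runCylinder b (N + n) (L (N + n)) i.1 i.2) ^ d ≤
            ENNReal.ofReal (2 * K * ρ ^ N * ρ ^ n) := by
          intro n
          rw [tsum_fintype]
          have h2 : ∀ i : (T (N + n) : Finset (ℕ → ℕ)) × Bool,
              Metric.ediam (runCylinder b (N + n) (L (N + n)) i.1 i.2) ^ d ≤
              ENNReal.ofReal ((((b : ℝ) ^ (N + n + L (N + n)))⁻¹) ^ d) := fun i => by
            rw [← ENNReal.ofReal_rpow_of_pos (by positivity)]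
            exact ENNReal.rpow_le_rpow (ediam_runCylinder_le hb _ _ _ _) hd.le
          refine (Finset.sum_le_sum fun i _ => h2 i).trans ?_
          rw [Finset.sum_const, nsmul_eq_mul, ← ENNReal.ofReal_natCast,
            ← ENNReal.ofReal_mul (by positivity)]
          refine ENNReal.ofReal_le_ofReal ?_
          have h3 := hT (N + n)
          rw [pow_add ρ] at h3
          simp only [Finset.card_univ, Fintype.card_prod, Fintype.card_coe, Fintype.card_bool]
          push_cast
          linarith
        refine (ENNReal.tsum_le_tsum h1).trans ?_
        rw [← ENNReal.ofReal_tsum_of_nonneg (fun n => by positivity)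
          ((summable_geometric_of_lt_one hρ0 hρ1).mul_left _), tsum_mul_left,
          tsum_geometric_of_lt_one hρ0 hρ1]
        refine ENNReal.ofReal_le_ofReal (le_of_eq ?_)
        ring
      have hlim : Tendsto (fun N : ℕ => ENNReal.ofReal (2 * K / (1 - ρ) * ρ ^ N)) atTop (𝓝 0) := by
        have := ENNReal.tendsto_ofReal
          ((tendsto_pow_atTop_nhds_zero_of_lt_one hρ0 hρ1).const_mul (2 * K / (1 - ρ)))
        rwa [mul_zero, ENNReal.ofReal_zero] at this
      exact (liminf_le_liminf (Eventually.of_forall hbound)).trans hlim.liminf_eq.le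
  have hcoe : ((d.toNNReal : ℝ≥0) : ℝ) = d := Real.coe_toNNReal d hd.le
  have := dimH_le_of_hausdorffMeasure_ne_top (s := E) (d := d.toNNReal)
    (by rw [hcoe, hzero]; exact ENNReal.zero_ne_top)
  exact this

lemma dimH_le_of_forall_cover_rpow (hb : 2 ≤ b) {s : ℕ} (hs : 1 ≤ s) {C d w β : ℝ} (hC : 0 ≤ C)
    (hd : 0 < d)
    (hdβ : Real.log s * β < d * (1 + w) * Real.log b) (T : ℕ → Finset (ℕ → ℕ))
    (hT : ∀ n : ℕ, ((T n).card : ℝ) ≤ C * (s : ℝ) ^ (β * n)) {E : Set ℝ}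
    (hE : ∀ ξ ∈ E, ∃ a : ℕ → ℕ, (∀ j, a j ≤ b - 1) ∧
      HasSum (fun j : ℕ => (a j : ℝ) / (b : ℝ) ^ (j + 1)) ξ ∧
      ∀ N : ℕ, ∃ n : ℕ, N ≤ n ∧ trunc n a ∈ T n ∧ IsRun b a n ⌊w * n⌋₊) :
    dimH E ≤ ENNReal.ofReal d := by
  have hb' : (1 : ℝ) < b := by exact_mod_cast hb
  have hb0 : (0 : ℝ) < b := by linarith
  have hs0 : (0 : ℝ) < s := by exact_mod_cast hs
  -- The factor `b ^ d` in `K` pays for the floor in the run length.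
  refine dimH_le_of_forall_cover hb hd (K := C * (b : ℝ) ^ d)
    (ρ := Real.exp (Real.log s * β - d * (1 + w) * Real.log b)) (by positivity)
    (Real.exp_pos _).le ((Real.exp_lt_exp.2 (by linarith)).trans_eq Real.exp_zero) (fun n => ⌊w * n⌋₊) T (fun n => ?_) hE
  refine (mul_le_mul_of_nonneg_right (hT n) (by positivity)).trans ?_
  rw [mul_assoc, mul_assoc]
  refine mul_le_mul_of_nonneg_left ?_ hC
  rw [inv_pow_eq_rpow, ← Real.rpow_mul hb0.le, Real.rpow_def_of_pos hs0, Real.rpow_def_of_pos hb0,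
    Real.rpow_def_of_pos hb0, ← Real.exp_nat_mul, ← Real.exp_add, ← Real.exp_add]
  refine Real.exp_le_exp.2 ?_
  have h1 := Nat.lt_floor_add_one (w * n)
  have h2 : 0 < Real.log b * d := mul_pos (Real.log_pos hb') hd
  push_cast
  nlinarith

end Cover


/-! ### Upper bounds for the dimension -/

lemma le_ofReal_of_forall_gt {c : ℝ≥0∞} {x : ℝ} (hx : 0 ≤ x)
    (h : ∀ d : ℝ, x < d → c ≤ ENNReal.ofReal d) : c ≤ ENNReal.ofReal x := by
  refine le_of_forall_gt_imp_ge_of_dense fun y hy => ?_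
  rcases eq_or_ne y ⊤ with rfl | hy'
  · exact le_top
  · rw [← ENNReal.ofReal_toReal hy'] at hy ⊢
    exact h _ ((ENNReal.ofReal_lt_ofReal_iff_of_nonneg hx).1 hy)

section Upper

variable {b : ℕ} {S : Finset ℕ}

/-- The starts of long runs are unbounded. -/
lemma RunBounds.exists_isStart {v w w' : ℝ} {M : ℕ} {a : ℕ → ℕ}
    (h : RunBounds b S v w' M a) (hw : 0 < w) (hw' : 0 ≤ w')
    (hrun : ∀ N : ℕ, ∃ n : ℕ, N ≤ n ∧ IsRun b a n ⌊w * n⌋₊) (N : ℕ) :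
    ∃ n : ℕ, N ≤ n ∧ IsStart a n ∧ IsRun b a n ⌊w * n⌋₊ := by
  -- Past `N₁` the run is too long to begin at or before `N`, so the start found by extending it to
  -- the left stays beyond `N`.
  obtain ⟨N₁, hN₁⟩ := exists_nat_forall_lt_mul hw (w' * N + M + 2)
  obtain ⟨n, hn, hr⟩ := hrun N₁
  have h1 := hN₁ n hn
  have h2 := Nat.lt_floor_add_one (w * n)
  have h0 : 0 ≤ w' * N := by positivity
  have hM : (0 : ℝ) ≤ M := by positivity
  have hpos : 0 < ⌊w * n⌋₊ := by
    have : (0 : ℝ) < ⌊w * n⌋₊ := by linarith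
    exact_mod_cast this
  obtain ⟨z, hz, hconst⟩ :
      ∃ z, (z = 0 ∨ z = b - 1) ∧ ∀ j, n ≤ j → j < n + ⌊w * n⌋₊ → a j = z := by
    rcases hr with hr | hr
    · exact ⟨0, Or.inl rfl, hr⟩
    · exact ⟨b - 1, Or.inr rfl, hr⟩
  obtain ⟨n', hn', hst, hconst'⟩ := exists_isStart_of_const (by omega) hconst
  have hrun' : IsRun b a n' (n + ⌊w * n⌋₊ - n') := by
    rcases hz with rfl | rfl
    · exact Or.inl fun j hj hj' => hconst' j hj (by omega)
    · exact Or.inr fun j hj hj' => hconst' j hj (by omega)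
  have hlen := h.length_le _ _ (hrun'.mono le_rfl (show n' + ⌊w * n⌋₊ ≤ _ by omega))
  have hN : N < n' := by
    by_contra! hle
    have h3 : (n' : ℝ) ≤ N := by exact_mod_cast hle
    have h4 : w' * n' ≤ w' * N := by gcongr
    linarith
  refine ⟨n', hN.le, hst.resolve_left (by omega), hrun'.mono le_rfl ?_⟩
  have : ⌊w * n'⌋₊ ≤ ⌊w * n⌋₊ := by gcongr
  omega

lemma exists_runBounds (hb : 2 ≤ b) (hS : ∀ s ∈ S, s ≤ b - 1) {ξ : ℝ} (hξ : ξ ∈ cantorSet b S)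
    (hne : ∀ n : ℕ, distInt ((b : ℝ) ^ n * ξ) ≠ 0) {v w w' : ℝ} (hv : 0 ≤ v) (hw : 0 < w)
    (hw' : 0 ≤ w') (h1 : (v : EReal) < vHatExp b ξ) (h2 : (w : EReal) < vExp b ξ)
    (h3 : vExp b ξ < w') :
    ∃ (M : ℕ) (a : ℕ → ℕ), RunBounds b S v w' M a ∧
      HasSum (fun j : ℕ => (a j : ℝ) / (b : ℝ) ^ (j + 1)) ξ ∧
      ∀ N : ℕ, ∃ n : ℕ, N ≤ n ∧ IsStart a n ∧ IsRun b a n ⌊w * n⌋₊ := by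
  obtain ⟨-, a, haS, hsum⟩ := hξ
  have ha : ∀ j, a j ≤ b - 1 := fun j => hS _ (haS j)
  obtain ⟨N₀, hN₀⟩ := exists_isRun_of_lt_vHatExp hb ha hsum hv h1
  obtain ⟨M, hM⟩ := exists_isRun_length_le_of_vExp_lt hb ha hsum hne hw' h3
  have hR : RunBounds b S v w' (max N₀ M) a := by
    refine ⟨haS, fun N hN => hN₀ N (le_of_max_le_left hN), fun n L hL => (hM n L hL).trans ?_⟩
    have : (M : ℝ) ≤ (max N₀ M : ℕ) := by exact_mod_cast le_max_right _ _
    linarith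
  exact ⟨_, a, hR, hsum, hR.exists_isStart hw hw' (exists_isRun_of_lt_vExp hb ha hsum hw.le h2)⟩

/-- The dimension bound when the uniform exponent exceeds `v` and the exponent lies in
the interval `(w, w')`. -/
lemma dimH_strip_le (hb : 2 ≤ b) (hS : ∀ s ∈ S, s ≤ b - 1) (hcard : 2 ≤ S.card)
    {v w w' d : ℝ} (hv : 0 < v) (hw : 0 < w) (hvw : v < w') (hd : 0 < d)
    (h : Real.log S.card * (1 - v * w' / (w' - v)) < d * (1 + w) * Real.log b) :
    dimH {ξ : ℝ | ξ ∈ cantorSet b S ∧ (∀ n : ℕ, distInt ((b : ℝ) ^ n * ξ) ≠ 0) ∧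
      (v : EReal) < vHatExp b ξ ∧ (w : EReal) < vExp b ξ ∧ vExp b ξ < w'} ≤
      ENNReal.ofReal d := by
  have hlog : 0 < Real.log S.card := Real.log_pos (by exact_mod_cast hcard)
  obtain ⟨β, hβ1, hβ2⟩ : ∃ β, 1 - v * w' / (w' - v) < β ∧
      β < min 1 (d * (1 + w) * Real.log b / Real.log S.card) := by
    refine exists_between (lt_min ?_ ?_)
    · have : 0 < v * w' / (w' - v) := div_pos (mul_pos hv (hv.trans hvw)) (by linarith)
      linarith
    · rw [lt_div_iff₀ hlog]
      linarith
  have hβ3 := (hβ2.trans_le (min_le_right _ _))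
  rw [lt_div_iff₀ hlog, mul_comm] at hβ3
  set E : ℕ → Set ℝ := fun M => {ξ | ∃ a : ℕ → ℕ, RunBounds b S v w' M a ∧
      HasSum (fun j : ℕ => (a j : ℝ) / (b : ℝ) ^ (j + 1)) ξ ∧
      ∀ N : ℕ, ∃ n : ℕ, N ≤ n ∧ IsStart a n ∧ IsRun b a n ⌊w * n⌋₊} with hE
  -- The count of words needs a fixed threshold `M`; countable stability of the dimension allows it
  -- to depend on the point.
  refine (dimH_mono (t := ⋃ M, E M) ?_).trans ?_
  · rintro ξ ⟨hξ, hne, h1, h2, h3⟩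
    rw [Set.mem_iUnion]
    exact exists_runBounds hb hS hξ hne hv.le hw (hv.trans hvw).le h1 h2 h3
  rw [dimH_iUnion]
  refine iSup_le fun M => ?_
  obtain ⟨C, T, hC, hT, hmem⟩ := exists_startWords_count b hcard hv hvw hβ1
    (hβ2.le.trans (min_le_left _ _)) M
  refine dimH_le_of_forall_cover_rpow hb (by omega) hC hd hβ3 T hT ?_
  rintro ξ ⟨a, ha, hsum, hinf⟩
  refine ⟨a, fun j => hS _ (ha.mem j), hsum, fun N => ?_⟩
  obtain ⟨n, hn, hst, hrun⟩ := hinf N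
  exact ⟨n, hn, hmem a ha n hst, hrun⟩

lemma dimH_le_of_forall_isRun (hb : 2 ≤ b) (hS : ∀ s ∈ S, s ≤ b - 1) (hcard : 2 ≤ S.card)
    {w d : ℝ} (hd : 0 < d)
    (h : Real.log S.card < d * (1 + w) * Real.log b) {E : Set ℝ}
    (hE : ∀ ξ ∈ E, ∃ a : ℕ → ℕ, (∀ j, a j ∈ S) ∧
      HasSum (fun j : ℕ => (a j : ℝ) / (b : ℝ) ^ (j + 1)) ξ ∧
      ∀ N : ℕ, ∃ n : ℕ, N ≤ n ∧ IsRun b a n ⌊w * n⌋₊) : dimH E ≤ ENNReal.ofReal d := by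
  refine dimH_le_of_forall_cover_rpow hb (s := S.card) (by omega) (C := 1) (w := w) (β := 1) zero_le_one hd
    (by linarith) (allWords S) (fun n => ?_) fun ξ hξ => ?_
  · rw [one_mul, one_mul, Real.rpow_natCast]
    exact_mod_cast card_allWords_le S n
  · obtain ⟨a, ha, hsum, hinf⟩ := hE ξ hξ
    refine ⟨a, fun j => hS _ (ha j), hsum, fun N => ?_⟩
    obtain ⟨n, hn, hrun⟩ := hinf N
    exact ⟨n, hn, trunc_mem_allWords ha n, hrun⟩

lemma dimH_cantorSet_le (hb : 2 ≤ b) (hS : ∀ s ∈ S, s ≤ b - 1) (hcard : 2 ≤ S.card) :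
    dimH (cantorSet b S) ≤ ENNReal.ofReal (Real.log S.card / Real.log b) := by
  have hlog : 0 < Real.log S.card := Real.log_pos (by exact_mod_cast hcard)
  have hlogb : 0 < Real.log b := Real.log_pos (by exact_mod_cast hb)
  refine le_ofReal_of_forall_gt (by positivity) fun d hd => ?_
  have hd0 : 0 < d := lt_of_le_of_lt (by positivity) hd
  rw [div_lt_iff₀ hlogb] at hd
  refine dimH_le_of_forall_isRun hb hS hcard (w := 0) hd0 (by linarith) ?_
  rintro ξ ⟨-, a, ha, hsum⟩
  exact ⟨a, ha, hsum, fun N => ⟨N, le_rfl, Or.inl fun j hj hj' => by simp at hj'; omega⟩⟩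

lemma dimH_setOf_vExp_eq_top_le (hb : 2 ≤ b) (hS : ∀ s ∈ S, s ≤ b - 1) (hcard : 2 ≤ S.card)
    {d : ℝ} (hd : 0 < d) :
    dimH {ξ : ℝ | ξ ∈ cantorSet b S ∧ vExp b ξ = ⊤} ≤ ENNReal.ofReal d := by
  have hlogb : 0 < Real.log b := Real.log_pos (by exact_mod_cast hb)
  obtain ⟨w, hw⟩ := exists_nat_gt (Real.log S.card / (d * Real.log b))
  rw [div_lt_iff₀ (by positivity)] at hw
  have : 0 < d * Real.log b := by positivity
  refine dimH_le_of_forall_isRun hb hS hcard (w := w) hd (by linarith) ?_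
  rintro ξ ⟨⟨-, a, ha, hsum⟩, htop⟩
  exact ⟨a, ha, hsum, exists_isRun_of_lt_vExp hb (fun j => hS _ (ha j)) hsum (Nat.cast_nonneg w)
    (by rw [htop]; exact EReal.coe_lt_top _)⟩

/-- If `b ^ n ξ` is an integer, so are all later multiples, and every real `v` is admissible. -/
lemma distInt_ne_zero_of_vExp_ne_top {ξ : ℝ} (hb : 2 ≤ b) (h : vExp b ξ ≠ ⊤) (n : ℕ) :
    distInt ((b : ℝ) ^ n * ξ) ≠ 0 := by
  intro h0
  refine h ((EReal.eq_top_iff_forall_lt _).2 fun x => ?_)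
  refine lt_of_lt_of_le (EReal.coe_lt_coe_iff.2 (lt_add_one x)) (le_sSup ⟨x + 1, ?_, rfl⟩)
  have hz : ∀ k, distInt ((b : ℝ) ^ (n + k) * ξ) = 0 := by
    intro k
    have h1 := sub_eq_zero.1 (abs_eq_zero.1 h0)
    rw [pow_add, mul_comm ((b : ℝ) ^ n), mul_assoc, h1]
    have := distInt_int_add ((b : ℤ) ^ k * round ((b : ℝ) ^ n * ξ)) 0
    push_cast at this
    rw [add_zero] at this
    rw [this]
    simp [distInt]
  refine Set.infinite_of_forall_exists_gt fun m => ⟨n + (m + 1), ⟨by omega, ?_⟩, by omega⟩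
  rw [hz]
  positivity

/-- Under `w (1 - v) < v` the rate `β` can be taken negative. The number of words before a start
then tends to `0`, while arbitrarily large starts exist. -/
lemma not_vExp_lt_of_lt_vHatExp (hb : 2 ≤ b) (hS : ∀ s ∈ S, s ≤ b - 1) (hcard : 2 ≤ S.card)
    {ξ : ℝ} (hξ : ξ ∈ cantorSet b S) {v w : ℝ} (hv : 0 < v) (hvw : v < w)
    (h : w * (1 - v) < v) (h1 : (v : EReal) < vHatExp b ξ) : ¬ vExp b ξ < w := by
  intro h2
  have hne := distInt_ne_zero_of_vExp_ne_top hb (h2.trans (EReal.coe_lt_top w)).ne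
  have h3 : (v : EReal) < vExp b ξ := by
    obtain ⟨-, a, ha, hsum⟩ := hξ
    exact h1.trans_le (vHatExp_le_vExp hb (fun j => hS _ (ha j)) hsum hne)
  obtain ⟨M, a, ha, hsum, hinf⟩ :=
    exists_runBounds hb hS hξ hne hv.le hv (hv.trans hvw).le h1 h3 h2
  have hneg : 1 - v * w / (w - v) < 0 := by
    rw [sub_neg, lt_div_iff₀ (by linarith)]
    linarith
  obtain ⟨β, hβ1, hβ2⟩ := exists_between hneg
  obtain ⟨C, T, hC, hT, hmem⟩ := exists_startWords_count b hcard hv hvw hβ1 (by linarith) M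
  have hs1 : (1 : ℝ) < S.card := by exact_mod_cast hcard
  have hlim : Tendsto (fun n : ℕ => C * ((S.card : ℝ) ^ β) ^ n) atTop (𝓝 (C * 0)) :=
    (tendsto_pow_atTop_nhds_zero_of_lt_one (by positivity)
      (Real.rpow_lt_one_of_one_lt_of_neg hs1 hβ2)).const_mul C
  rw [mul_zero] at hlim
  obtain ⟨N, hN⟩ := eventually_atTop.1 (hlim.eventually_lt_const zero_lt_one)
  obtain ⟨n, hn, hst, -⟩ := hinf N
  have h4 : (1 : ℝ) ≤ (T n).card := by
    exact_mod_cast Finset.card_pos.2 ⟨_, hmem a ha n hst⟩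
  have h5 := hN n hn
  rw [← Real.rpow_natCast, ← Real.rpow_mul (by linarith)] at h5
  exact absurd (h4.trans (hT n)) h5.not_ge

/-- The difference of the two sides is a perfect square over a positive quantity; equality holds at
`w = 2 v / (1 - v)`, which is `θ = 2 / (1 - v)`. -/
lemma strip_ratio_le {v w : ℝ} (hv : 0 < v) (hvw : v < w) :
    1 - v * w / (w - v) ≤ ((1 - v) / (1 + v)) ^ 2 * (1 + w) := by
  have h1 : 0 < w - v := by linarith
  rw [← sub_nonneg]
  have : ((1 - v) / (1 + v)) ^ 2 * (1 + w) - (1 - v * w / (w - v)) =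
      ((1 - v) * w - 2 * v) ^ 2 / ((1 + v) ^ 2 * (w - v)) := by
    field_simp
    ring
  rw [this]
  positivity

lemma dimH_setOf_le_vHatExp_le (hb : 2 ≤ b) (hS : ∀ s ∈ S, s ≤ b - 1) (hcard : 2 ≤ S.card)
    {v : ℝ} (hv : 0 ≤ v) :
    dimH {ξ : ℝ | ξ ∈ cantorSet b S ∧ (v : EReal) ≤ vHatExp b ξ} ≤
      ENNReal.ofReal (Real.log S.card / Real.log b * ((1 - v) / (1 + v)) ^ 2) := by
  have hlog : 0 < Real.log S.card := Real.log_pos (by exact_mod_cast hcard)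
  have hlogb : 0 < Real.log b := Real.log_pos (by exact_mod_cast hb)
  rcases hv.eq_or_lt with rfl | hv
  · simpa using (dimH_mono fun ξ hξ => hξ.1).trans (dimH_cantorSet_le hb hS hcard)
  refine le_ofReal_of_forall_gt (by positivity) fun d hd => ?_
  have hd0 : 0 < d := lt_of_le_of_lt (by positivity) hd
  -- `t` is both the loss in `v` and the mesh for `v_b`. The factor `1 + 2 * t` bounds `(1 + w') /
  -- (1 + w)` on a strip with `w' = w + 2 * t`.
  obtain ⟨t, ht, htv, ht0⟩ : ∃ t : ℝ,
      Real.log S.card / Real.log b * (((1 - (v - t)) / (1 + (v - t))) ^ 2 * (1 + 2 * t)) < d ∧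
      t < v ∧ 0 < t := by
    have hcont : ContinuousAt (fun t : ℝ => Real.log S.card / Real.log b *
        (((1 - (v - t)) / (1 + (v - t))) ^ 2 * (1 + 2 * t))) 0 := by
      have : (1 + (v - 0)) ≠ 0 := by linarith
      fun_prop (disch := assumption)
    have h1 := hcont.eventually_lt_const (u := d) (by simpa using hd)
    exact ((h1.filter_mono nhdsWithin_le_nhds).and
      (((gt_mem_nhds hv).filter_mono nhdsWithin_le_nhds).and
        (self_mem_nhdsWithin : Set.Ioi (0 : ℝ) ∈ 𝓝[>] 0))).exists
  set v' := v - t with hv'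
  have hv0 : 0 < v' := by linarith
  -- Strips of width `2 * t` with step `t` overlap, so the open strips miss no finite value of the
  -- exponent.
  set strip : ℕ → Set ℝ := fun i => {ξ : ℝ | ξ ∈ cantorSet b S ∧
    (∀ n : ℕ, distInt ((b : ℝ) ^ n * ξ) ≠ 0) ∧ (v' : EReal) < vHatExp b ξ ∧
    ((v' + i * t : ℝ) : EReal) < vExp b ξ ∧ vExp b ξ < ((v' + (i + 2) * t : ℝ) : EReal)}
    with hstrip
  have hsub : {ξ : ℝ | ξ ∈ cantorSet b S ∧ (v : EReal) ≤ vHatExp b ξ} ⊆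
      {ξ : ℝ | ξ ∈ cantorSet b S ∧ vExp b ξ = ⊤} ∪ ⋃ i, strip i := by
    rintro ξ ⟨hξ, hvξ⟩
    by_cases htop : vExp b ξ = ⊤
    · exact Or.inl ⟨hξ, htop⟩
    right
    have hne := distInt_ne_zero_of_vExp_ne_top hb htop
    have h1 : (v : EReal) ≤ vExp b ξ := by
      obtain ⟨-, a, ha, hsum⟩ := hξ
      exact hvξ.trans (vHatExp_le_vExp hb (fun j => hS _ (ha j)) hsum hne)
    have hbot : vExp b ξ ≠ ⊥ := ((EReal.bot_lt_coe v).trans_le h1).ne'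
    obtain ⟨x, hx⟩ : ∃ x : ℝ, vExp b ξ = x := ⟨_, (EReal.coe_toReal htop hbot).symm⟩
    have hvx : v ≤ x := by rw [hx] at h1; exact_mod_cast h1
    have hpos : 0 < (x - v') / t := div_pos (by linarith) ht0
    obtain ⟨i, hi⟩ := Nat.exists_eq_add_of_lt (Nat.ceil_pos.2 hpos)
    rw [zero_add] at hi
    have h2 := Nat.le_ceil ((x - v') / t)
    have h3 := Nat.ceil_lt_add_one hpos.le
    rw [hi] at h2 h3
    push_cast at h2 h3
    rw [div_le_iff₀ ht0] at h2
    have h3 : (i : ℝ) < (x - v') / t := by linarith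
    rw [lt_div_iff₀ ht0] at h3
    refine Set.mem_iUnion.2 ⟨i, hξ, hne, ?_, ?_, ?_⟩
    · exact lt_of_lt_of_le (EReal.coe_lt_coe_iff.2 (by linarith)) hvξ
    · rw [hx]
      exact EReal.coe_lt_coe_iff.2 (by linarith)
    · rw [hx]
      exact EReal.coe_lt_coe_iff.2 (by linarith)
  refine (dimH_mono hsub).trans ?_
  rw [dimH_union, dimH_iUnion]
  refine max_le (dimH_setOf_vExp_eq_top_le hb hS hcard hd0) (iSup_le fun i => ?_)
  have hit : 0 ≤ i * t := by positivity
  refine dimH_strip_le hb hS hcard hv0 (by linarith) (by linarith) hd0 ?_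
  have h1 := strip_ratio_le hv0 (show v' < v' + (i + 2) * t by linarith)
  set h := ((1 - v') / (1 + v')) ^ 2 with hh
  have hh0 : 0 ≤ h := by positivity
  have h2 : h * (1 + (v' + (i + 2) * t)) ≤ h * ((1 + 2 * t) * (1 + (v' + i * t))) := by
    refine mul_le_mul_of_nonneg_left ?_ hh0
    nlinarith
  rw [div_mul_eq_mul_div, div_lt_iff₀ hlogb] at ht
  calc Real.log S.card * (1 - v' * (v' + (i + 2) * t) / (v' + (i + 2) * t - v'))
      ≤ Real.log S.card * (h * ((1 + 2 * t) * (1 + (v' + i * t)))) := by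
        gcongr
        exact h1.trans h2
    _ = Real.log S.card * (h * (1 + 2 * t)) * (1 + (v' + i * t)) := by ring
    _ < d * Real.log b * (1 + (v' + i * t)) := by
        gcongr
    _ = _ := by ring

lemma dimH_setOf_vHatExp_eq_inter_vExp_eq_le (hb : 2 ≤ b) (hS : ∀ s ∈ S, s ≤ b - 1)
    (hcard : 2 ≤ S.card) {θ v : ℝ} (hv : 0 < v) (hv1 : v < 1) (hθ : 1 / (1 - v) ≤ θ) :
    dimH {ξ : ℝ | ξ ∈ cantorSet b S ∧ vHatExp b ξ = (v : EReal) ∧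
      vExp b ξ = ((θ * v : ℝ) : EReal)} ≤
      ENNReal.ofReal (Real.log S.card / Real.log b *
        ((θ - 1 - θ * v) / ((1 + θ * v) * (θ - 1)))) := by
  have hlog : 0 < Real.log S.card := Real.log_pos (by exact_mod_cast hcard)
  have hlogb : 0 < Real.log b := Real.log_pos (by exact_mod_cast hb)
  rw [div_le_iff₀ (by linarith)] at hθ
  have hθ1 : 1 < θ := by nlinarith
  have hθv : 0 < θ * v := by positivity
  have hg : 0 ≤ (θ - 1 - θ * v) / ((1 + θ * v) * (θ - 1)) :=
    div_nonneg (by linarith) (mul_nonneg (by linarith) (by linarith))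
  refine le_ofReal_of_forall_gt (by positivity) fun d hd => ?_
  have hd0 : 0 < d := lt_of_le_of_lt (by positivity) hd
  -- At `t = 0` the strict inequality is exactly `hd`; it persists for small `t > 0` by continuity.
  obtain ⟨t, ht, htv, ht0⟩ : ∃ t : ℝ,
      Real.log S.card * (1 - (v - t) * (θ * v + t) / ((θ * v + t) - (v - t))) -
        d * (1 + (θ * v - t)) * Real.log b < 0 ∧ t < v ∧ 0 < t := by
    have hcont : ContinuousAt (fun t : ℝ =>
        Real.log S.card * (1 - (v - t) * (θ * v + t) / ((θ * v + t) - (v - t))) -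
        d * (1 + (θ * v - t)) * Real.log b) 0 := by
      have : (θ * v + 0) - (v - 0) ≠ 0 := by nlinarith
      fun_prop (disch := assumption)
    have hlt : Real.log S.card * (1 - (v - 0) * (θ * v + 0) / ((θ * v + 0) - (v - 0))) -
        d * (1 + (θ * v - 0)) * Real.log b < 0 := by
      have e : Real.log S.card * (1 - (v - 0) * (θ * v + 0) / ((θ * v + 0) - (v - 0))) =
          Real.log S.card / Real.log b * ((θ - 1 - θ * v) / ((1 + θ * v) * (θ - 1))) *
            ((1 + θ * v) * Real.log b) := by
        have h1 : θ - 1 ≠ 0 := by linarith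
        have h2 : (θ * v + 0) - (v - 0) = v * (θ - 1) := by ring
        rw [h2]
        field_simp
        ring
      rw [e]
      have : 0 < (1 + θ * v) * Real.log b := by positivity
      nlinarith
    have h1 := hcont.eventually_lt_const hlt
    exact ((h1.filter_mono nhdsWithin_le_nhds).and
      (((gt_mem_nhds hv).filter_mono nhdsWithin_le_nhds).and
        (self_mem_nhdsWithin : Set.Ioi (0 : ℝ) ∈ 𝓝[>] 0))).exists
  have hvθ : v < θ * v := by nlinarith
  refine (dimH_mono ?_).trans (dimH_strip_le hb hS hcard (v := v - t) (w := θ * v - t)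
    (w' := θ * v + t) (by linarith) (by linarith) (by linarith) hd0 (by linarith))
  rintro ξ ⟨hξ, h1, h2⟩
  refine ⟨hξ, distInt_ne_zero_of_vExp_ne_top hb (by rw [h2]; exact EReal.coe_ne_top _),
    ?_, ?_, ?_⟩
  · rw [h1]
    exact EReal.coe_lt_coe_iff.2 (by linarith)
  · rw [h2]
    exact EReal.coe_lt_coe_iff.2 (by linarith)
  · rw [h2]
    exact EReal.coe_lt_coe_iff.2 (by linarith)

end Upper


/-! ### Separation of digit sequences -/

section Separation

variable {b : ℕ} {a a' : ℕ → ℕ}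

/-- Tails can differ by `1` only if all digits are `0` against `b - 1`; agreement at one place
leaves a definite gap. -/
lemma abs_digitTail_sub_le_of_agree (hb : 2 ≤ b) (ha : ∀ j, a j ≤ b - 1)
    (ha' : ∀ j, a' j ≤ b - 1) (m n : ℕ) (h : a (n + m) = a' (n + m)) :
    |digitTail b a n - digitTail b a' n| ≤ 1 - ((b : ℝ) ^ (m + 1))⁻¹ := by
  have hb' : (2 : ℝ) ≤ b := by exact_mod_cast hb
  have hb0 : (0 : ℝ) < b := by positivity
  induction m generalizing n with
  | zero =>
    have h1 := abs_digitTail_sub_le hb ha ha' n 1 fun j hj hj' => by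
      rw [show j = n + 0 by omega, h]
    rw [pow_one] at h1
    have h2 : (b : ℝ)⁻¹ ≤ 2⁻¹ := inv_anti₀ (by norm_num) hb'
    rw [zero_add, pow_one]
    linarith
  | succ m ih =>
    have h1 := ih (n + 1) (by rw [show n + 1 + m = n + (m + 1) by ring, h])
    have h2 := digitTail_succ hb ha n
    have h3 := digitTail_succ hb ha' n
    have h4 : |(a n : ℝ) - a' n| ≤ b - 1 := by
      have := digit_le_sub_one hb ha n
      have := digit_le_sub_one hb ha' n
      have : (0 : ℝ) ≤ a n := by positivity
      have : (0 : ℝ) ≤ a' n := by positivity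
      rw [abs_le]
      constructor <;> linarith
    have h5 : (b : ℝ) * |digitTail b a n - digitTail b a' n| ≤ b - ((b : ℝ) ^ (m + 1))⁻¹ := by
      rw [← abs_of_pos hb0, ← abs_mul, abs_of_pos hb0, mul_sub, h2, h3, add_sub_add_comm]
      refine (abs_add_le _ _).trans ?_
      linarith
    rw [← mul_le_mul_iff_right₀ hb0]
    refine h5.trans (le_of_eq ?_)
    rw [pow_succ _ (m + 1), mul_inv]
    field_simp

/-- Sequences such as `1000…` and `0(b-1)(b-1)…` have different first digits but equal values, so a
first difference alone does not separate. A later agreement keeps the tails from cancelling it. -/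
lemma le_abs_digitTail_sub (hb : 2 ≤ b) (ha : ∀ j, a j ≤ b - 1) (ha' : ∀ j, a' j ≤ b - 1)
    (m k n : ℕ) (h : ∀ j, n ≤ j → j < n + k → a j = a' j) (hk : a (n + k) ≠ a' (n + k))
    (hm : a (n + k + 1 + m) = a' (n + k + 1 + m)) :
    ((b : ℝ) ^ (k + m + 2))⁻¹ ≤ |digitTail b a n - digitTail b a' n| := by
  have hb0 : (0 : ℝ) < b := by positivity
  induction k generalizing n with
  | zero =>
    have h1 := abs_digitTail_sub_le_of_agree hb ha ha' m (n + 1) hm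
    have h2 := digitTail_succ hb ha n
    have h3 := digitTail_succ hb ha' n
    have h4 : (1 : ℝ) ≤ |(a n : ℝ) - a' n| := by
      have : (1 : ℤ) ≤ |(a n : ℤ) - a' n| := by
        refine Int.one_le_abs (sub_ne_zero.2 ?_)
        exact_mod_cast hk
      exact_mod_cast this
    have h5 : ((b : ℝ) ^ (m + 1))⁻¹ ≤ b * |digitTail b a n - digitTail b a' n| := by
      rw [← abs_of_pos hb0, ← abs_mul, abs_of_pos hb0, mul_sub, h2, h3, add_sub_add_comm]
      have := abs_sub_abs_le_abs_sub ((a n : ℝ) - a' n)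
        (-(digitTail b a (n + 1) - digitTail b a' (n + 1)))
      rw [abs_neg, sub_neg_eq_add] at this
      linarith
    rw [← mul_le_mul_iff_right₀ hb0]
    refine le_trans (le_of_eq ?_) h5
    rw [show 0 + m + 2 = m + 1 + 1 by ring, pow_succ _ (m + 1), mul_inv]
    field_simp
  | succ k ih =>
    have h1 := ih (n + 1) (fun j hj hj' => h j (by omega) (by omega))
      (by rwa [show n + 1 + k = n + (k + 1) by ring])
      (by rwa [show n + 1 + k = n + (k + 1) by ring])
    have h2 := digitTail_succ hb ha n
    have h3 := digitTail_succ hb ha' n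
    rw [h n le_rfl (by omega)] at h2
    have h5 : ((b : ℝ) ^ (k + m + 2))⁻¹ ≤ b * |digitTail b a n - digitTail b a' n| := by
      rw [← abs_of_pos hb0, ← abs_mul, abs_of_pos hb0, mul_sub, h2, h3, add_sub_add_left_eq_sub]
      exact h1
    rw [← mul_le_mul_iff_right₀ hb0]
    refine le_trans (le_of_eq ?_) h5
    rw [show k + 1 + m + 2 = k + m + 2 + 1 by ring, pow_succ _ (k + m + 2), mul_inv]
    field_simp

end Separation

/-! ### Pattern sequences and the dimension of pattern sets -/

lemma exists_mod_eq_of_lt {q : ℕ} (m : ℕ) {r : ℕ} (hr : r < q) :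
    ∃ j, m ≤ j ∧ j < m + q ∧ j % q = r := by
  have h := Nat.div_add_mod m q
  have h2 := Nat.mod_lt m (show 0 < q by omega)
  by_cases hle : m % q ≤ r
  · exact ⟨q * (m / q) + r, by omega, by omega, by rw [Nat.mul_add_mod, Nat.mod_eq_of_lt hr]⟩
  · refine ⟨q * (m / q + 1) + r, ?_, ?_, by rw [Nat.mul_add_mod, Nat.mod_eq_of_lt hr]⟩ <;>
      rw [mul_add_one] <;> omega

lemma mul_count_mod_lt_two_le {q : ℕ} (hq : 0 < q) (j : ℕ) :
    q * Nat.count (fun i => i % q < 2) j ≤ 2 * j + 2 * q := by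
  have hcq : Nat.count (fun i => i % q < 2) q ≤ 2 := by
    rw [Nat.count_eq_card_filter_range]
    refine (Finset.card_le_card (t := {0, 1}) fun i hi => ?_).trans Finset.card_le_two
    simp only [Finset.mem_filter, Finset.mem_range] at hi
    rw [Nat.mod_eq_of_lt hi.1] at hi
    simp only [Finset.mem_insert, Finset.mem_singleton]
    omega
  induction j using Nat.strong_induction_on with
  | _ j ih =>
  by_cases hj : j < q
  · have := (Nat.count_monotone (fun i => i % q < 2) hj.le).trans hcq
    nlinarith
  · obtain ⟨k, rfl⟩ := Nat.exists_eq_add_of_le (not_lt.1 hj)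
    have h1 := ih k (by omega)
    rw [Nat.count_add]
    simp only [Nat.add_mod_left]
    nlinarith

/-- The digit sequences in `S` whose digits are `e` on `P`, and outside of `P` are `c` on the
multiples of `q` and `e` right after them. -/
structure IsPattern (S : Finset ℕ) (P : ℕ → Prop) (q c e : ℕ) (a : ℕ → ℕ) : Prop where
  mem : ∀ j, a j ∈ S
  eq_of_pos : ∀ j, P j → a j = e
  eq_left : ∀ j, ¬ P j → j % q = 0 → a j = c
  eq_right : ∀ j, ¬ P j → j % q = 1 → a j = e

/-- The real numbers whose digits follow a given pattern. -/
def patternSet (b : ℕ) (S : Finset ℕ) (P : ℕ → Prop) (q c e : ℕ) : Set ℝ :=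
  {ξ | ∃ a, IsPattern S P q c e a ∧ HasSum (fun j : ℕ => (a j : ℝ) / (b : ℝ) ^ (j + 1)) ξ}

section Lower

variable {b : ℕ} {S : Finset ℕ} {P : ℕ → Prop} {q c e : ℕ}

lemma le_count_free [DecidablePred P] (hq : 0 < q) {ρ : ℝ}
    (hP : ∀ j : ℕ, (Nat.count P j : ℝ) ≤ ρ * j) {δ : ℝ} (hδ : δ ≤ 1 - ρ - 2 / q) (j : ℕ) :
    δ * j - 2 ≤ Nat.count (fun i => ¬ P i ∧ 2 ≤ i % q) j := by
  have h1 : j ≤ Nat.count (fun i => ¬ P i ∧ 2 ≤ i % q) j + Nat.count P j +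
      Nat.count (fun i => i % q < 2) j := by
    induction j with
    | zero => simp
    | succ j ih =>
      simp only [Nat.count_succ]
      grind
  have h2 : (q : ℝ) * Nat.count (fun i => i % q < 2) j ≤ 2 * j + 2 * q := by
    exact_mod_cast mul_count_mod_lt_two_le hq j
  have hq' : (0 : ℝ) < q := by exact_mod_cast hq
  have h3 : (Nat.count (fun i => i % q < 2) j : ℝ) ≤ 2 / q * j + 2 := by
    rw [← mul_le_mul_iff_right₀ hq']
    refine h2.trans (le_of_eq ?_)
    field_simp
  have h4 : (j : ℝ) ≤ Nat.count (fun i => ¬ P i ∧ 2 ≤ i % q) j + Nat.count P j +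
      Nat.count (fun i => i % q < 2) j := by exact_mod_cast h1
  have h5 := hP j
  have h6 : δ * j ≤ (1 - ρ - 2 / q) * j := by gcongr
  linarith

open scoped Classical in
/-- The pattern sequence with the free digits prescribed by `ω`. -/
noncomputable def fillPattern (S : Finset ℕ) (P : ℕ → Prop) (q c e : ℕ) (ω : ℕ → Fin S.card) :
    ℕ → ℕ := fun j =>
  if P j then e else if j % q = 0 then c else if j % q = 1 then e else
    S.equivFin.symm (ω (Nat.count (fun i => ¬ P i ∧ 2 ≤ i % q) j))

lemma isPattern_fillPattern (hc : c ∈ S) (he : e ∈ S) (ω : ℕ → Fin S.card) :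
    IsPattern S P q c e (fillPattern S P q c e ω) := by
  refine ⟨fun j => ?_, fun j hj => ?_, fun j hj hj' => ?_, fun j hj hj' => ?_⟩
  · unfold fillPattern
    split_ifs
    · exact he
    · exact hc
    · exact he
    · exact Finset.coe_mem _
  all_goals simp [fillPattern, *]

/-- If the first differing free digit has index `i` and position `k`, the left side is at most `s ^
(-i)` with `i ≥ δ k - 2`, and the values differ by at least `b ^ (-(k + q + 1))`. The two factors of
the constant pay for the `2` and for the `q + 1`. -/
lemma exists_abs_sub_le_of_fillPattern (hb : 2 ≤ b) (hS : ∀ s ∈ S, s ≤ b - 1)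
    (hcard : 2 ≤ S.card) (hc : c ∈ S) (he : e ∈ S) (hq : 0 < q)
    {δ : ℝ} (hδ0 : 0 < δ) (hcount : ∀ j : ℕ, δ * j - 2 ≤
      (open scoped Classical in Nat.count (fun i => ¬ P i ∧ 2 ≤ i % q) j))
    {ω ω' : ℕ → Fin S.card} :
    |Real.ofDigits ω - Real.ofDigits ω'| ≤
      (S.card : ℝ) ^ (2 : ℝ) * (b : ℝ) ^ ((q + 1) * (δ * (Real.log S.card / Real.log b))) *
      |digitTail b (fillPattern S P q c e ω) 0 - digitTail b (fillPattern S P q c e ω') 0| ^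
        (δ * (Real.log S.card / Real.log b)) := by
  classical
  by_cases hne : ω = ω'
  · rw [hne, sub_self, abs_zero]
    positivity
  have hs0 : (0 : ℝ) < S.card := by positivity
  have hb0 : (0 : ℝ) < b := by positivity
  have hb1 : (1 : ℝ) < b := by exact_mod_cast hb
  have hlog : 0 < Real.log S.card := Real.log_pos (by exact_mod_cast hcard)
  have hlogb : 0 < Real.log b := Real.log_pos (by exact_mod_cast hb)
  set free : ℕ → Prop := fun i => ¬ P i ∧ 2 ≤ i % q with hfree
  have hcount : ∀ j : ℕ, δ * j - 2 ≤ Nat.count free j := fun j => by convert hcount j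
  have hinf : (Set.ofPred free).Infinite := by
    intro hfin
    obtain ⟨N, hN⟩ := exists_nat_forall_lt_mul hδ0 (2 + hfin.toFinset.card)
    have h1 := hN N le_rfl
    have h2 := hcount N
    have h3 : (Nat.count free N : ℝ) ≤ hfin.toFinset.card := by
      exact_mod_cast Nat.count_le_card hfin N
    linarith
  obtain ⟨i, hi, hmin⟩ : ∃ i, ω i ≠ ω' i ∧ ∀ j < i, ω j = ω' j := by
    have hex : ∃ i, ω i ≠ ω' i := Function.ne_iff.1 hne
    exact ⟨Nat.find hex, Nat.find_spec hex, fun j hj => not_not.1 (Nat.find_min hex hj)⟩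
  set k := Nat.nth free i with hk
  have hfk : free k := Nat.nth_mem_of_infinite hinf i
  have hki : Nat.count free k = i := Nat.count_nth_of_infinite hinf i
  have ha := isPattern_fillPattern (P := P) (q := q) hc he ω
  have ha' := isPattern_fillPattern (P := P) (q := q) hc he ω'
  have hval : ∀ (ω : ℕ → Fin S.card) (j : ℕ), free j →
      fillPattern S P q c e ω j = S.equivFin.symm (ω (Nat.count free j)) := by
    intro ω j hj
    have h0 : ¬ j % q = 0 := fun h => by have := hj.2; omega
    have h1 : ¬ j % q = 1 := fun h => by have := hj.2; omega
    simp only [fillPattern, if_neg hj.1, if_neg h0, if_neg h1]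
    congr!
  have hfix : ∀ j, ¬ free j → fillPattern S P q c e ω j = fillPattern S P q c e ω' j := by
    intro j hj
    by_cases hPj : P j
    · rw [ha.eq_of_pos j hPj, ha'.eq_of_pos j hPj]
    · have h2 : j % q < 2 := by
        by_contra! h
        exact hj ⟨hPj, h⟩
      rcases (show j % q = 0 ∨ j % q = 1 by omega) with h | h
      · rw [ha.eq_left j hPj h, ha'.eq_left j hPj h]
      · rw [ha.eq_right j hPj h, ha'.eq_right j hPj h]
  -- The next multiple of `q` is never free, so both sequences agree there again within `q` places.
  obtain ⟨p, hp1, hp2, hp3⟩ := exists_mod_eq_of_lt (k + 1) hq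
  obtain ⟨m, rfl⟩ := Nat.exists_eq_add_of_le hp1
  have hsep := le_abs_digitTail_sub hb (fun j => hS _ (ha.mem j)) (fun j => hS _ (ha'.mem j))
    m k 0 (fun j _ hj => ?_) ?_ ?_
  rotate_left
  · by_cases hf : free j
    · rw [hval ω j hf, hval ω' j hf, hmin]
      rw [← hki]
      exact Nat.count_strict_mono hf (by omega)
    · exact hfix j hf
  · rw [zero_add, hval ω k hfk, hval ω' k hfk, hki]
    intro h
    exact hi (S.equivFin.symm.injective (Subtype.ext h))
  · rw [zero_add]
    refine hfix _ fun hf => ?_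
    have := hf.2
    omega
  refine (Real.abs_ofDigits_sub_ofDigits_le hmin).trans ?_
  set D := δ * (Real.log S.card / Real.log b) with hD
  have hD0 : 0 < D := by positivity
  have h1 : ((b : ℝ) ^ (k + q + 1))⁻¹ ≤ ((b : ℝ) ^ (k + m + 2))⁻¹ := by
    exact inv_anti₀ (by positivity) (pow_le_pow_right₀ hb1.le (by omega))
  have h2 : (((b : ℝ) ^ (k + q + 1))⁻¹) ^ D ≤ _ :=
    Real.rpow_le_rpow (by positivity) (h1.trans hsep) hD0.le
  refine le_trans ?_ (mul_le_mul_of_nonneg_left h2 (by positivity))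
  rw [inv_pow_eq_rpow, inv_pow_eq_rpow, ← Real.rpow_mul hb0.le, Real.rpow_def_of_pos hs0,
    Real.rpow_def_of_pos hs0, Real.rpow_def_of_pos hb0, Real.rpow_def_of_pos hb0, ← Real.exp_add,
    ← Real.exp_add]
  refine Real.exp_le_exp.2 ?_
  have h3 := hcount k
  rw [hki] at h3
  have h4 : Real.log b * D = δ * Real.log S.card := by
    rw [hD]
    field_simp
  push_cast
  have h5 : Real.log S.card * 2 + Real.log b * ((q + 1) * D) + Real.log b * (-(k + q + 1) * D) =
      Real.log S.card * 2 - k * (Real.log b * D) := by ring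
  rw [h5, h4]
  nlinarith

lemma le_dimH_patternSet (hb : 2 ≤ b) (hS : ∀ s ∈ S, s ≤ b - 1) (hcard : 2 ≤ S.card)
    (hc : c ∈ S) (he : e ∈ S) (hq : 0 < q) [DecidablePred P] {ρ : ℝ}
    (hP : ∀ j : ℕ, (Nat.count P j : ℝ) ≤ ρ * j) {δ : ℝ} (hδ0 : 0 < δ)
    (hδ : δ ≤ 1 - ρ - 2 / q) :
    ENNReal.ofReal (δ * (Real.log S.card / Real.log b)) ≤ dimH (patternSet b S P q c e) := by
  have hlog : 0 < Real.log S.card := Real.log_pos (by exact_mod_cast hcard)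
  have hlogb : 0 < Real.log b := Real.log_pos (by exact_mod_cast hb)
  have : NeZero S.card := ⟨by omega⟩
  set D := δ * (Real.log S.card / Real.log b) with hD
  have hD0 : 0 < D := by positivity
  set K := (S.card : ℝ) ^ (2 : ℝ) * (b : ℝ) ^ ((q + 1) * D) with hK
  set G : ℝ → ℝ := fun y => digitTail b (fillPattern S P q c e (Real.digits y S.card)) 0 with hG
  have hdist : ∀ y ∈ Set.Ico (0 : ℝ) 1, ∀ y' ∈ Set.Ico (0 : ℝ) 1,
      |y - y'| ≤ K * |G y - G y'| ^ D := by
    intro y hy y' hy'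
    have h := exists_abs_sub_le_of_fillPattern (P := P) hb hS hcard hc he hq hδ0
      (fun j => by convert le_count_free hq hP hδ j) (ω := Real.digits y S.card)
      (ω' := Real.digits y' S.card)
    rwa [Real.ofDigits_digits (by omega) hy, Real.ofDigits_digits (by omega) hy'] at h
  have hinj : Set.InjOn G (Set.Ico 0 1) := by
    intro y hy y' hy' h
    have := hdist y hy y' hy'
    rw [h, sub_self, abs_zero, Real.zero_rpow hD0.ne', mul_zero] at this
    exact sub_eq_zero.1 (abs_eq_zero.1 (le_antisymm this (abs_nonneg _)))
  have hleft := hinj.leftInvOn_invFunOn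
  set f := Function.invFunOn G (Set.Ico 0 1) with hf
  -- The inverse of `G` is `D`-Hölder and maps onto an interval of dimension `1`, so the image of
  -- `G` has dimension at least `D`; no measure on the pattern set is needed.
  have hholder : HolderOnWith K.toNNReal D.toNNReal f (G '' Set.Ico 0 1) := by
    rintro _ ⟨y, hy, rfl⟩ _ ⟨y', hy', rfl⟩
    rw [hleft hy, hleft hy', Real.coe_toNNReal D hD0.le, edist_dist, edist_dist, Real.dist_eq,
      Real.dist_eq, ENNReal.ofReal_rpow_of_nonneg (abs_nonneg _) hD0.le]
    change _ ≤ ENNReal.ofReal K * _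
    rw [← ENNReal.ofReal_mul (by positivity)]
    exact ENNReal.ofReal_le_ofReal (hdist y hy y' hy')
  have h1 := hholder.dimH_image_le (Real.toNNReal_pos.2 hD0)
  rw [hleft.image_image, Real.dimH_of_nonempty_interior (by simp)] at h1
  rw [Module.finrank_self, Nat.cast_one, ENNReal.le_div_iff_mul_le
    (Or.inl (by simpa using hD0)) (Or.inl ENNReal.coe_ne_top), one_mul] at h1
  refine le_trans h1 (dimH_mono ?_)
  rintro _ ⟨y, hy, rfl⟩
  have ha := isPattern_fillPattern (P := P) (q := q) hc he (Real.digits y S.card)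
  refine ⟨_, ha, ?_⟩
  have := (summable_digits_shift hb (fun j => hS _ (ha.mem j)) 0).hasSum
  simpa [hG, digitTail] using this

lemma patternSet_subset (hb : 2 ≤ b) (hS : ∀ s ∈ S, s ≤ b - 1) :
    patternSet b S P q c e ⊆ cantorSet b S := by
  rintro ξ ⟨a, ha, hsum⟩
  have h : digitTail b a 0 = ξ := by simpa [digitTail] using hsum.tsum_eq
  exact ⟨⟨h ▸ digitTail_nonneg 0, h ▸ digitTail_le_one hb (fun j => hS _ (ha.mem j)) 0⟩, a,
    ha.mem, hsum⟩

end Lower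


/-! ### Patterns with geometric blocks: runs, exponents, density -/

section Runs

variable {b : ℕ} {S : Finset ℕ} {P : ℕ → Prop} {q c e : ℕ} {a : ℕ → ℕ}

/-- A run of a pattern sequence longer than the period meets `P`, and it contains a multiple of
the period only at positions of `P`. -/
lemma IsPattern.isRun_cases (ha : IsPattern S P q c e a) (hce : c ≠ e) (hq : 2 ≤ q) {n L : ℕ}
    (h : IsRun b a n L) (hL : q < L) :
    (∃ i, n ≤ i ∧ i < n + q ∧ P i) ∧ ∀ j, n ≤ j → j < n + L → j % q = 0 → P j := by
  obtain ⟨z, hz⟩ : ∃ z, ∀ j, n ≤ j → j < n + L → a j = z := by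
    rcases h with h | h
    · exact ⟨_, h⟩
    · exact ⟨_, h⟩
  have hex : ∃ i, n ≤ i ∧ i < n + q ∧ P i := by
    by_contra! hno
    obtain ⟨j, h1, h2, h3⟩ := exists_mod_eq_of_lt n (show 0 < q by omega)
    obtain ⟨j', h1', h2', h3'⟩ := exists_mod_eq_of_lt n (show 1 < q by omega)
    apply hce
    rw [← ha.eq_left j (hno j h1 h2) h3, ← ha.eq_right j' (hno j' h1' h2') h3',
      hz j h1 (by omega), hz j' h1' (by omega)]
  refine ⟨hex, fun j h1 h2 h3 => ?_⟩
  obtain ⟨i, hi1, hi2, hi3⟩ := hex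
  by_contra hPj
  apply hce
  rw [← ha.eq_left j hPj h3, ← ha.eq_of_pos i hi3, hz j h1 h2, hz i hi1 (by omega)]

/-- The positions `j` with `θ ^ k ≤ j < (1 + θ v) θ ^ k` for some `k ≥ k₀`. -/
def LongRuns (θ v : ℝ) (k₀ : ℕ) (j : ℕ) : Prop :=
  ∃ k : ℕ, k₀ ≤ k ∧ θ ^ k ≤ j ∧ j < (1 + θ * v) * θ ^ k

variable {θ v : ℝ} {k₀ : ℕ}

lemma not_longRuns (hθ : 1 < θ) (hv : 0 ≤ v) {k j : ℕ} (h1 : (1 + θ * v) * θ ^ k ≤ j)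
    (h2 : j < θ ^ (k + 1)) : ¬ LongRuns θ v k₀ j := by
  rintro ⟨k', -, h3, h4⟩
  have h5 : k' < k + 1 := (pow_lt_pow_iff_right₀ hθ).1 (h3.trans_lt h2)
  have h6 : θ ^ k' ≤ θ ^ k := pow_le_pow_right₀ hθ.le (by omega)
  have h7 : 0 < 1 + θ * v := by nlinarith
  nlinarith

lemma le_of_longRuns (hθ : 1 < θ) {j : ℕ} (h : LongRuns θ v k₀ j) : θ ^ k₀ ≤ j := by
  obtain ⟨k, h1, h2, -⟩ := h
  exact (pow_le_pow_right₀ hθ.le h1).trans h2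

lemma isRun_longRuns (he : e = 0 ∨ e = b - 1) (ha : IsPattern S (LongRuns θ v k₀) q c e a)
    (hθ : 1 < θ) (hv : 0 < v) {k : ℕ} (hk : k₀ ≤ k) :
    ∃ L : ℕ, IsRun b a ⌈θ ^ k⌉₊ L ∧ θ * v * θ ^ k - 2 ≤ L := by
  have hpos : 0 < θ ^ k := by positivity
  have hconst : ∀ j, ⌈θ ^ k⌉₊ ≤ j → j < ⌈θ ^ k⌉₊ + (⌊θ * v * θ ^ k⌋₊ - 1) → a j = e := by
    intro j h1 h2
    refine ha.eq_of_pos j ⟨k, hk, Nat.ceil_le.1 h1, ?_⟩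
    have h3 := Nat.ceil_lt_add_one hpos.le
    have h4 := Nat.floor_le (a := θ * v * θ ^ k) (by positivity)
    have h5 : j + 2 ≤ ⌈θ ^ k⌉₊ + ⌊θ * v * θ ^ k⌋₊ := by omega
    have h6 : (j : ℝ) + 2 ≤ ⌈θ ^ k⌉₊ + ⌊θ * v * θ ^ k⌋₊ := by exact_mod_cast h5
    linarith
  refine ⟨⌊θ * v * θ ^ k⌋₊ - 1, ?_, ?_⟩
  · rcases he with rfl | rfl
    · exact Or.inl hconst
    · exact Or.inr hconst
  · have h3 := Nat.lt_floor_add_one (θ * v * θ ^ k)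
    have h4 : ⌊θ * v * θ ^ k⌋₊ ≤ ⌊θ * v * θ ^ k⌋₊ - 1 + 1 := by omega
    have h5 : (⌊θ * v * θ ^ k⌋₊ : ℝ) ≤ ((⌊θ * v * θ ^ k⌋₊ - 1 : ℕ) : ℝ) + 1 := by exact_mod_cast h4
    linarith

/-- A longer run would pass the end of its block and reach the next multiple of `q`, which carries
`c`. The condition on `k₀` makes each gap between blocks long enough to contain that multiple. -/
lemma length_le_of_longRuns (ha : IsPattern S (LongRuns θ v k₀) q c e a) (hce : c ≠ e)
    (hq : 2 ≤ q) (hθ : 1 < θ) (hv : 0 < v) (hθv : 1 + θ * v < θ)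
    (hk₀ : (q : ℝ) + 1 ≤ (θ - (1 + θ * v)) * θ ^ k₀) {n L : ℕ} (h : IsRun b a n L) (hL : q < L) :
    ∃ k i : ℕ, θ ^ k ≤ i ∧ i < n + q ∧ (L : ℝ) ≤ θ * v * θ ^ k + 2 * q + 1 := by
  obtain ⟨⟨i, hi1, hi2, k, hk, hi3, hi4⟩, hmul⟩ := ha.isRun_cases hce hq h hL
  refine ⟨k, i, hi3, hi2, ?_⟩
  have hpos : 0 < θ ^ k := by positivity
  have hi2' : (i : ℝ) + 1 ≤ n + q := by exact_mod_cast hi2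
  by_contra! hlt
  obtain ⟨j, h1, h2, h3⟩ := exists_mod_eq_of_lt ⌈(1 + θ * v) * θ ^ k⌉₊ (show 0 < q by omega)
  have h4 := Nat.ceil_lt_add_one (a := (1 + θ * v) * θ ^ k) (by positivity)
  have h5 := Nat.ceil_le.1 h1
  have h6 : (j : ℝ) + 1 ≤ ⌈(1 + θ * v) * θ ^ k⌉₊ + q := by exact_mod_cast h2
  have h7 : (θ - (1 + θ * v)) * θ ^ k₀ ≤ (θ - (1 + θ * v)) * θ ^ k :=
    mul_le_mul_of_nonneg_left (pow_le_pow_right₀ hθ.le hk) (by linarith)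
  have hij : (i : ℝ) < j := by linarith
  have hij : i < j := by exact_mod_cast hij
  have hjL : (j : ℝ) < n + L := by linarith
  have hjL : j < n + L := by exact_mod_cast hjL
  refine not_longRuns (k₀ := k₀) hθ hv.le h5 ?_ (hmul j (by omega) hjL h3)
  rw [pow_succ']
  linarith

lemma vExp_eq_of_longRuns (hb : 2 ≤ b) (hS : ∀ s ∈ S, s ≤ b - 1) (he : e = 0 ∨ e = b - 1)
    (ha : IsPattern S (LongRuns θ v k₀) q c e a) (hce : c ≠ e)
    (hq : 2 ≤ q) (hθ : 1 < θ) (hv : 0 < v) (hθv : 1 + θ * v < θ)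
    (hk₀ : (q : ℝ) + 1 ≤ (θ - (1 + θ * v)) * θ ^ k₀) {ξ : ℝ}
    (hξ : HasSum (fun j : ℕ => (a j : ℝ) / (b : ℝ) ^ (j + 1)) ξ) :
    vExp b ξ = ((θ * v : ℝ) : EReal) := by
  have ha' : ∀ j, a j ≤ b - 1 := fun j => hS _ (ha.mem j)
  have hθv0 : 0 < θ * v := by positivity
  refine le_antisymm (vExp_le_of_isRun hb ha' hξ (C := θ * v * q + 2 * q + 1) hθv0.le
    fun n L h => ?_) (le_vExp_of_isRun hb ha' hξ (C := 2 + θ * v) fun N₀ => ?_)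
  · by_cases hL : q < L
    · obtain ⟨k, i, h1, h2, h3⟩ := length_le_of_longRuns ha hce hq hθ hv hθv hk₀ h hL
      have h4 : (i : ℝ) + 1 ≤ n + q := by exact_mod_cast h2
      have h5 : θ * v * θ ^ k ≤ θ * v * (n + q) := by
        gcongr
        linarith
      linarith
    · have h1 : (L : ℝ) ≤ q := by exact_mod_cast not_lt.1 hL
      have h2 : 0 ≤ θ * v * n := by positivity
      have h3 : 0 ≤ θ * v * q := by positivity
      linarith
  · obtain ⟨k, hk⟩ := pow_unbounded_of_one_lt (N₀ : ℝ) hθ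
    obtain ⟨L, h1, h2⟩ := isRun_longRuns he ha hθ hv (le_max_right k k₀)
    refine ⟨_, L, ?_, h1, ?_⟩
    · have h3 : (N₀ : ℝ) ≤ ⌈θ ^ max k k₀⌉₊ :=
        (hk.le.trans (pow_le_pow_right₀ hθ.le (le_max_left _ _))).trans (Nat.le_ceil _)
      exact_mod_cast h3
    · have h3 := Nat.ceil_lt_add_one (a := θ ^ max k k₀) (by positivity)
      have h4 : θ * v * ⌈θ ^ max k k₀⌉₊ ≤ θ * v * (θ ^ max k k₀ + 1) := by gcongr
      linarith

lemma vHatExp_eq_of_longRuns (hb : 2 ≤ b) (hS : ∀ s ∈ S, s ≤ b - 1) (he : e = 0 ∨ e = b - 1)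
    (ha : IsPattern S (LongRuns θ v k₀) q c e a) (hce : c ≠ e)
    (hq : 2 ≤ q) (hθ : 1 < θ) (hv : 0 < v) (hθv : 1 + θ * v < θ)
    (hk₀ : (q : ℝ) + 1 ≤ (θ - (1 + θ * v)) * θ ^ k₀) {ξ : ℝ}
    (hξ : HasSum (fun j : ℕ => (a j : ℝ) / (b : ℝ) ^ (j + 1)) ξ) :
    vHatExp b ξ = (v : EReal) := by
  have ha' : ∀ j, a j ≤ b - 1 := fun j => hS _ (ha.mem j)
  refine le_antisymm (vHatExp_le_of_isRun hb ha' hξ (C := v * (q + 1) + 2 * q + 1) hv.le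
    fun N₀ => ?_) (le_vHatExp_of_isRun hb ha' hξ (C := 2) (N₀ := ⌈θ ^ k₀⌉₊) fun N hN => ?_)
  · obtain ⟨k, hk⟩ := pow_unbounded_of_one_lt ((N₀ : ℝ) + q) hθ
    have hk' : (N₀ : ℝ) + q < θ ^ (k + 1) := hk.trans (pow_lt_pow_right₀ hθ (by omega))
    have h1 : N₀ + q ≤ ⌊θ ^ (k + 1)⌋₊ := by
      refine Nat.le_floor ?_
      push_cast
      exact hk'.le
    have h0 := Nat.floor_le (a := θ ^ (k + 1)) (by positivity)
    have h2 := Nat.lt_floor_add_one (θ ^ (k + 1))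
    -- A long run may meet its block up to `q` places after its beginning; subtracting `q` excludes
    -- block `k + 1`. The longest block left has length `θ v θ ^ k = v θ ^ (k + 1)`, about `v N`.
    refine ⟨⌊θ ^ (k + 1)⌋₊ - q, by omega, fun n L hn h => ?_⟩
    set N := ⌊θ ^ (k + 1)⌋₊ - q with hN
    have hNq : ⌊θ ^ (k + 1)⌋₊ = N + q := by omega
    rw [hNq] at h0 h2
    push_cast at h0 h2
    by_cases hL : q < L
    · obtain ⟨k', i, h3, h4, h5⟩ := length_le_of_longRuns ha hce hq hθ hv hθv hk₀ h hL
      have h6 : (i : ℝ) < N + q := by exact_mod_cast (show i < N + q by omega)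
      have h7 : k' < k + 1 := (pow_lt_pow_iff_right₀ hθ).1 (by linarith)
      have h8 : θ * v * θ ^ k' ≤ θ * v * θ ^ k := by
        gcongr
        · exact hθ.le
        · omega
      have h9 : θ * v * θ ^ k = v * θ ^ (k + 1) := by ring
      have h10 : v * θ ^ (k + 1) ≤ v * (N + q + 1) := by gcongr
      linarith
    · have h1 : (L : ℝ) ≤ q := by exact_mod_cast not_lt.1 hL
      have h2 : 0 ≤ v * N := by positivity
      have h3 : 0 ≤ v * (q + 1) := by positivity
      linarith
  · have hN' : θ ^ k₀ ≤ N := Nat.ceil_le.1 hN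
    obtain ⟨k, h1, h2⟩ := exists_nat_pow_near ((one_le_pow₀ hθ.le).trans hN') hθ
    have hk : k₀ < k + 1 := (pow_lt_pow_iff_right₀ hθ).1 (hN'.trans_lt h2)
    obtain ⟨L, h3, h4⟩ := isRun_longRuns he ha hθ hv (show k₀ ≤ k by omega)
    refine ⟨_, L, Nat.one_le_ceil_iff.2 (by positivity), Nat.ceil_le.2 h1, h3, ?_⟩
    have h5 : v * N ≤ v * θ ^ (k + 1) := by gcongr
    have h6 : θ * v * θ ^ k = v * θ ^ (k + 1) := by ring
    linarith

lemma vHatExp_eq_zero_of_isPattern (hb : 2 ≤ b) (hS : ∀ s ∈ S, s ≤ b - 1)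
    (ha : IsPattern S (fun _ => False) q c e a) (hce : c ≠ e) (hq : 2 ≤ q) {ξ : ℝ}
    (hξ : HasSum (fun j : ℕ => (a j : ℝ) / (b : ℝ) ^ (j + 1)) ξ) : vHatExp b ξ = 0 := by
  refine le_antisymm ?_ (vHatExp_nonneg b ξ hb)
  refine vHatExp_le_of_isRun hb (fun j => hS _ (ha.mem j)) hξ (v := 0) (C := q) le_rfl
    fun N₀ => ⟨N₀, le_rfl, fun n L _ h => ?_⟩
  have h1 : L ≤ q := by
    by_contra! hL
    obtain ⟨⟨i, -, -, hi⟩, -⟩ := ha.isRun_cases hce hq h hL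
    exact hi
  have : (L : ℝ) ≤ q := by exact_mod_cast h1
  linarith

/-- The exact block count up to `θ ^ k` is about `θ v / (θ - 1)` times `θ ^ k`; `σ` is slightly
larger, and the condition on `k₀` pays for the ceilings. The proportion of block positions is
largest at the end of a block, where `σ θ ^ (k + 1)` is divided by `(1 + θ v) θ ^ k`. -/
lemma count_longRuns_le [DecidablePred (LongRuns θ v k₀)] (hθ : 1 < θ) (hv : 0 < v)
    {σ : ℝ} (hσ0 : 0 ≤ σ) (hσ1 : σ * θ ≤ 1 + θ * v)
    (hk₀ : 1 ≤ (σ * (θ - 1) - θ * v) * θ ^ k₀) (j : ℕ) :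
    (Nat.count (LongRuns θ v k₀) j : ℝ) ≤ σ * θ / (1 + θ * v) * j := by
  have hτ : 0 < 1 + θ * v := by positivity
  have hstep : ∀ m k : ℕ, m ≤ k →
      Nat.count (LongRuns θ v k₀) k ≤ Nat.count (LongRuns θ v k₀) m + (k - m) := by
    intro m k hmk
    obtain ⟨d, rfl⟩ := Nat.exists_eq_add_of_le hmk
    rw [Nat.count_add, Nat.add_sub_cancel_left]
    exact Nat.add_le_add_left (Nat.count_le _) _
  have hgap : ∀ k m : ℕ, m ≤ ⌈θ ^ (k + 1)⌉₊ → Nat.count (LongRuns θ v k₀) m ≤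
      Nat.count (LongRuns θ v k₀) ⌈(1 + θ * v) * θ ^ k⌉₊ := by
    intro k m hm
    by_contra! hlt
    obtain ⟨x, ⟨hx1, hx2⟩, hx3⟩ := Nat.exists_of_count_lt_count hlt
    exact not_longRuns hθ hv.le (Nat.ceil_le.1 hx1) (Nat.lt_ceil.1 (hx2.trans_le hm)) hx3
  have hzero : ∀ m : ℕ, m ≤ ⌈θ ^ k₀⌉₊ → Nat.count (LongRuns θ v k₀) m = 0 := by
    intro m hm
    rw [Nat.count_iff_forall_not]
    intro i hi h
    exact (Nat.lt_ceil.1 (hi.trans_le hm)).not_ge (le_of_longRuns hθ h)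
  have hpow : ∀ k : ℕ, (Nat.count (LongRuns θ v k₀) ⌈θ ^ k⌉₊ : ℝ) ≤ σ * θ ^ k := by
    intro k
    induction k with
    | zero =>
      rw [hzero _ (by gcongr; exact hθ.le; omega)]
      push_cast
      positivity
    | succ k ih =>
      by_cases hk : k + 1 ≤ k₀
      · rw [hzero _ (by gcongr; exact hθ.le)]
        push_cast
        positivity
      have hθk : 0 < θ ^ k := by positivity
      have hle : ⌈θ ^ k⌉₊ ≤ ⌈(1 + θ * v) * θ ^ k⌉₊ := by
        gcongr
        have : 0 < θ * v := by positivity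
        nlinarith
      have h1 := (hgap k _ le_rfl).trans (hstep _ _ hle)
      have h2 : (Nat.count (LongRuns θ v k₀) ⌈θ ^ (k + 1)⌉₊ : ℝ) ≤
          Nat.count (LongRuns θ v k₀) ⌈θ ^ k⌉₊ + (⌈(1 + θ * v) * θ ^ k⌉₊ - ⌈θ ^ k⌉₊) := by
        rw [← Nat.cast_sub hle]
        exact_mod_cast h1
      have h3 := Nat.ceil_lt_add_one (a := (1 + θ * v) * θ ^ k) (by positivity)
      have h4 := Nat.le_ceil (θ ^ k)
      have h5 : θ ^ k₀ ≤ θ ^ k := pow_le_pow_right₀ hθ.le (by omega)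
      have h6 : 0 < σ * (θ - 1) - θ * v := by
        by_contra! hle
        have : 0 < θ ^ k₀ := by positivity
        nlinarith
      have h7 : 1 ≤ (σ * (θ - 1) - θ * v) * θ ^ k := hk₀.trans (by gcongr)
      have h8 : σ * θ ^ (k + 1) = σ * (θ - 1) * θ ^ k + σ * θ ^ k := by ring
      linarith
  by_cases hj : j ≤ ⌈θ ^ k₀⌉₊
  · rw [hzero j hj]
    push_cast
    positivity
  have hj1 : θ ^ k₀ ≤ j := Nat.ceil_le.1 (by omega)
  obtain ⟨k, h1, h2⟩ := exists_nat_pow_near ((one_le_pow₀ hθ.le).trans hj1) hθ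
  have hk : k₀ < k + 1 := (pow_lt_pow_iff_right₀ hθ).1 (hj1.trans_lt h2)
  have hkk : θ ^ k₀ ≤ θ ^ k := pow_le_pow_right₀ hθ.le (by omega)
  have hpos : 0 < θ ^ k := by positivity
  set ρ := σ * θ / (1 + θ * v) with hρ
  have hρτ : ρ * (1 + θ * v) = σ * θ := div_mul_cancel₀ _ hτ.ne'
  have hρ1 : ρ ≤ 1 := (div_le_one hτ).2 hσ1
  by_cases hjτ : (j : ℝ) ≤ (1 + θ * v) * θ ^ k
  · have hle : ⌈θ ^ k⌉₊ ≤ j := Nat.ceil_le.2 h1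
    have h3 : (Nat.count (LongRuns θ v k₀) j : ℝ) ≤
        Nat.count (LongRuns θ v k₀) ⌈θ ^ k⌉₊ + (j - ⌈θ ^ k⌉₊) := by
      rw [← Nat.cast_sub hle]
      exact_mod_cast hstep _ _ hle
    have h4 := hpow k
    have h5 := Nat.le_ceil (θ ^ k)
    have h6 : (1 - ρ) * j ≤ (1 - ρ) * ((1 + θ * v) * θ ^ k) :=
      mul_le_mul_of_nonneg_left hjτ (by linarith)
    have h7 : (1 - ρ) * ((1 + θ * v) * θ ^ k) = (1 + θ * v - σ * θ) * θ ^ k := by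
      rw [← hρτ]
      ring
    have h8 : 0 ≤ (σ * (θ - 1) - θ * v) * θ ^ k := by
      have : 0 < θ ^ k₀ := by positivity
      have : 0 < σ * (θ - 1) - θ * v := by
        by_contra! hle
        nlinarith
      positivity
    linarith
  · push Not at hjτ
    have h3 : Nat.count (LongRuns θ v k₀) j ≤ Nat.count (LongRuns θ v k₀) ⌈θ ^ (k + 1)⌉₊ :=
      Nat.count_monotone _ (by exact_mod_cast h2.le.trans (Nat.le_ceil _))
    have h4 := hpow (k + 1)
    have h5 : (Nat.count (LongRuns θ v k₀) j : ℝ) ≤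
      Nat.count (LongRuns θ v k₀) ⌈θ ^ (k + 1)⌉₊ := by exact_mod_cast h3
    have h6 : ρ * ((1 + θ * v) * θ ^ k) ≤ ρ * j :=
      mul_le_mul_of_nonneg_left hjτ.le (by positivity)
    have h7 : ρ * ((1 + θ * v) * θ ^ k) = σ * θ ^ (k + 1) := by
      rw [← mul_assoc, hρτ]
      ring
    linarith

end Runs

/-! ### Lower bounds for the dimension -/

section LowerBounds

variable {b : ℕ} {S : Finset ℕ}

lemma ofReal_mul_le_of_forall_lt {c : ℝ≥0∞} {x l : ℝ} (hx : 0 ≤ x)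
    (h : ∀ d : ℝ, 0 < d → d < x → ENNReal.ofReal (d * l) ≤ c) : ENNReal.ofReal (x * l) ≤ c := by
  rcases hx.eq_or_lt with rfl | hx
  · simp
  have hcont : ContinuousAt (fun d : ℝ => ENNReal.ofReal (d * l)) x :=
    (ENNReal.continuous_ofReal.comp (continuous_mul_const l)).continuousAt
  refine le_of_tendsto (hcont.tendsto.mono_left (nhdsWithin_le_nhds (s := Set.Iio x))) ?_
  filter_upwards [self_mem_nhdsWithin, (lt_mem_nhds hx).filter_mono nhdsWithin_le_nhds]
    with d hd hd0
  exact h d hd0 hd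

lemma exists_two_div_lt {t : ℝ} (ht : 0 < t) : ∃ q : ℕ, 2 ≤ q ∧ 2 / (q : ℝ) < t := by
  obtain ⟨q, hq⟩ := exists_nat_forall_lt_mul ht 2
  have h := hq (max q 2) (le_max_left _ _)
  refine ⟨max q 2, le_max_right _ _, ?_⟩
  rw [div_lt_iff₀ (by exact_mod_cast (by omega : 0 < max q 2))]
  exact h

lemma exists_digits (hcard : 2 ≤ S.card) (hdigit : 0 ∈ S ∨ b - 1 ∈ S) :
    ∃ c e, c ∈ S ∧ e ∈ S ∧ c ≠ e ∧ (e = 0 ∨ e = b - 1) := by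
  obtain ⟨e, he, he'⟩ : ∃ e ∈ S, e = 0 ∨ e = b - 1 := by
    rcases hdigit with h | h
    · exact ⟨_, h, Or.inl rfl⟩
    · exact ⟨_, h, Or.inr rfl⟩
  obtain ⟨c, hc, hce⟩ := Finset.exists_mem_ne (show 1 < S.card by omega) e
  exact ⟨c, e, hc, he, hce, he'⟩

lemma le_dimH_setOf_vHatExp_eq_zero (hb : 2 ≤ b) (hS : ∀ s ∈ S, s ≤ b - 1) (hcard : 2 ≤ S.card)
    (hdigit : 0 ∈ S ∨ b - 1 ∈ S) :
    ENNReal.ofReal (Real.log S.card / Real.log b) ≤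
      dimH {ξ : ℝ | ξ ∈ cantorSet b S ∧ vHatExp b ξ = 0} := by
  obtain ⟨c, e, hc, he, hce, -⟩ := exists_digits hcard hdigit
  rw [← one_mul (Real.log S.card / Real.log b)]
  refine ofReal_mul_le_of_forall_lt zero_le_one fun d hd0 hd => ?_
  obtain ⟨q, hq, hqd⟩ := exists_two_div_lt (sub_pos.2 hd)
  refine (le_dimH_patternSet (P := fun _ => False) (q := q) hb hS hcard hc he (by omega) (ρ := 0)
    (by simp) hd0 (by linarith)).trans (dimH_mono fun ξ hξ => ⟨patternSet_subset hb hS hξ, ?_⟩)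
  obtain ⟨a, ha, hsum⟩ := hξ
  exact vHatExp_eq_zero_of_isPattern hb hS ha hce hq hsum

lemma le_dimH_setOf_vHatExp_eq_inter_vExp_eq (hb : 2 ≤ b) (hS : ∀ s ∈ S, s ≤ b - 1)
    (hcard : 2 ≤ S.card) (hdigit : 0 ∈ S ∨ b - 1 ∈ S) {θ v : ℝ} (hv : 0 < v) (hv1 : v < 1)
    (hθ : 1 / (1 - v) ≤ θ) :
    ENNReal.ofReal (Real.log S.card / Real.log b *
        ((θ - 1 - θ * v) / ((1 + θ * v) * (θ - 1)))) ≤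
      dimH {ξ : ℝ | ξ ∈ cantorSet b S ∧ vHatExp b ξ = (v : EReal) ∧
        vExp b ξ = ((θ * v : ℝ) : EReal)} := by
  classical
  obtain ⟨c, e, hc, he, hce, he'⟩ := exists_digits hcard hdigit
  rw [div_le_iff₀ (by linarith)] at hθ
  have hθ1 : 1 < θ := by nlinarith
  have hθv0 : 0 < θ * v := by positivity
  have hθ1' : 0 < θ - 1 := by linarith
  -- If `1 + θ v = θ` the blocks leave no gaps, but the claimed bound is then `0`.
  rcases (show 1 + θ * v ≤ θ by linarith).eq_or_lt with heq | hθv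
  · rw [show θ - 1 - θ * v = 0 by linarith]
    simp
  rw [mul_comm (Real.log S.card / Real.log b)]
  refine ofReal_mul_le_of_forall_lt (div_nonneg (by linarith) (by positivity)) fun d hd0 hd => ?_
  set x := (θ - 1 - θ * v) / ((1 + θ * v) * (θ - 1)) with hx
  obtain ⟨q, hq, hqd⟩ := exists_two_div_lt (half_pos (sub_pos.2 hd))
  -- The slack `x - d` is shared equally: one half raises the block density above its limit `1 - x`,
  -- the other covers the marker density `2 / q`.
  set ρ := 1 - x + (x - d) / 2 with hρ
  set σ := ρ * (1 + θ * v) / θ with hσ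
  have hσρ : σ * θ / (1 + θ * v) = ρ := by
    rw [hσ]
    field_simp
  have hx1 : (1 - x) * (1 + θ * v) * (θ - 1) = θ * (θ * v) := by
    rw [hx]
    field_simp
    ring
  have hσ1 : 0 < σ * (θ - 1) - θ * v := by
    have : σ * (θ - 1) - θ * v = (x - d) / 2 * (1 + θ * v) * (θ - 1) / θ := by
      rw [hσ, hρ]
      field_simp
      linarith
    rw [this]
    have : 0 < x - d := by linarith
    positivity
  have hσ0 : 0 ≤ σ := by
    by_contra! h
    nlinarith
  obtain ⟨k₁, hk₁⟩ := pow_unbounded_of_one_lt (((q : ℝ) + 1) / (θ - (1 + θ * v))) hθ1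
  obtain ⟨k₂, hk₂⟩ := pow_unbounded_of_one_lt (1 / (σ * (θ - 1) - θ * v)) hθ1
  have h1 := hk₁.le.trans (pow_le_pow_right₀ hθ1.le (le_max_left k₁ k₂))
  have h2 := hk₂.le.trans (pow_le_pow_right₀ hθ1.le (le_max_right k₁ k₂))
  rw [div_le_iff₀' (by linarith)] at h1 h2
  have hcount := count_longRuns_le (k₀ := max k₁ k₂) hθ1 hv hσ0 (by
    rw [hσ, div_mul_cancel₀ _ (by linarith)]
    have : ρ ≤ 1 := by linarith
    nlinarith) h2
  rw [hσρ] at hcount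
  refine (le_dimH_patternSet (q := q) hb hS hcard hc he (by omega) hcount hd0 (by linarith)).trans
    (dimH_mono fun ξ hξ => ⟨patternSet_subset hb hS hξ, ?_⟩)
  obtain ⟨a, ha, hsum⟩ := hξ
  exact ⟨vHatExp_eq_of_longRuns hb hS he' ha hce hq hθ1 hv hθv h1 hsum,
    vExp_eq_of_longRuns hb hS he' ha hce hq hθ1 hv hθv h1 hsum⟩

lemma le_dimH_setOf_vHatExp_eq (hb : 2 ≤ b) (hS : ∀ s ∈ S, s ≤ b - 1)
    (hcard : 2 ≤ S.card) (hdigit : 0 ∈ S ∨ b - 1 ∈ S) {v : ℝ} (hv : 0 ≤ v) (hv1 : v ≤ 1) :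
    ENNReal.ofReal (Real.log S.card / Real.log b * ((1 - v) / (1 + v)) ^ 2) ≤
      dimH {ξ : ℝ | ξ ∈ cantorSet b S ∧ vHatExp b ξ = (v : EReal)} := by
  rcases hv.eq_or_lt with rfl | hv
  · simpa using le_dimH_setOf_vHatExp_eq_zero hb hS hcard hdigit
  rcases hv1.eq_or_lt with rfl | hv1
  · simp
  -- The value `θ = 2 / (1 - v)` maximizes the dimension in (i) and turns it into the square.
  have h1 : 0 < 1 - v := by linarith
  have h := le_dimH_setOf_vHatExp_eq_inter_vExp_eq hb hS hcard hdigit hv hv1 (θ := 2 / (1 - v))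
    (by gcongr; norm_num)
  have e : (2 / (1 - v) - 1 - 2 / (1 - v) * v) / ((1 + 2 / (1 - v) * v) * (2 / (1 - v) - 1)) =
      ((1 - v) / (1 + v)) ^ 2 := by
    have e1 : 2 / (1 - v) - 1 - 2 / (1 - v) * v = 1 := by
      field_simp
      ring
    have e2 : 1 + 2 / (1 - v) * v = (1 + v) / (1 - v) := by
      field_simp
      ring
    have e3 : 2 / (1 - v) - 1 = (1 + v) / (1 - v) := by
      field_simp
      ring
    rw [e1, e2, e3]
    field_simp
  rw [e] at h
  exact h.trans (dimH_mono fun ξ hξ => ⟨hξ.1, hξ.2.1⟩)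

end LowerBounds

end BaryApprox

/-! ### Assembly of the three statements -/

theorem theorem6p1 (b : ℕ) (hb : 3 ≤ b) (S : Finset ℕ) (hS : ∀ s ∈ S, s ≤ b - 1)
    (hcard : 2 ≤ S.card) (hdigit : 0 ∈ S ∨ b - 1 ∈ S) :
    (∀ θ v : ℝ, 0 < θ → 0 < v → v < 1 →
      (θ < 1 / (1 - v) →
        {ξ : ℝ | ξ ∈ BaryApprox.cantorSet b S ∧ (v : EReal) ≤ BaryApprox.vHatExp b ξ} ∩
          {ξ : ℝ | ξ ∈ BaryApprox.cantorSet b S ∧ BaryApprox.vExp b ξ = ((θ * v : ℝ) : EReal)}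
            = ∅) ∧
      (1 / (1 - v) ≤ θ →
        dimH ({ξ : ℝ | ξ ∈ BaryApprox.cantorSet b S ∧ BaryApprox.vHatExp b ξ = (v : EReal)} ∩
          {ξ : ℝ | ξ ∈ BaryApprox.cantorSet b S ∧ BaryApprox.vExp b ξ = ((θ * v : ℝ) : EReal)})
            = ENNReal.ofReal (Real.log (S.card : ℝ) / Real.log (b : ℝ) *
                ((θ - 1 - θ * v) / ((1 + θ * v) * (θ - 1)))))) ∧
    dimH {ξ : ℝ | ξ ∈ BaryApprox.cantorSet b S ∧ BaryApprox.vHatExp b ξ = 1} = 0 ∧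
    (∀ v : ℝ, 0 ≤ v → v ≤ 1 →
      dimH {ξ : ℝ | ξ ∈ BaryApprox.cantorSet b S ∧ (v : EReal) ≤ BaryApprox.vHatExp b ξ}
          = ENNReal.ofReal (Real.log (S.card : ℝ) / Real.log (b : ℝ) *
              ((1 - v) / (1 + v)) ^ 2) ∧
      dimH {ξ : ℝ | ξ ∈ BaryApprox.cantorSet b S ∧ BaryApprox.vHatExp b ξ = (v : EReal)}
          = ENNReal.ofReal (Real.log (S.card : ℝ) / Real.log (b : ℝ) *
              ((1 - v) / (1 + v)) ^ 2)) := by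
  have hb2 : 2 ≤ b := by omega
  have hsub : ∀ v : ℝ, {ξ : ℝ | ξ ∈ BaryApprox.cantorSet b S ∧
      BaryApprox.vHatExp b ξ = (v : EReal)} ⊆
      {ξ : ℝ | ξ ∈ BaryApprox.cantorSet b S ∧ (v : EReal) ≤ BaryApprox.vHatExp b ξ} :=
    fun v ξ hξ => ⟨hξ.1, hξ.2.ge⟩
  refine ⟨fun θ v hθ hv hv1 => ⟨fun hlt => ?_, fun hle => ?_⟩, ?_, fun v hv hv1 => ?_⟩
  · rw [Set.eq_empty_iff_forall_notMem]
    rintro ξ ⟨⟨hξ, h1⟩, -, h2⟩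
    rw [lt_div_iff₀ (by linarith)] at hlt
    -- Since `θ v < v / (1 - v)`, there is room for `w` above `v_b` and then, as `w / (1 + w) < v`,
    -- for `u < v` with `w (1 - u) < u`. The maximum with `v` ensures `u < w`.
    obtain ⟨w, hw1, hw2⟩ : ∃ w, max (θ * v) v < w ∧ w < v / (1 - v) := by
      refine exists_between (max_lt ?_ ?_) <;> rw [lt_div_iff₀ (by linarith)] <;> nlinarith
    rw [lt_div_iff₀ (by linarith)] at hw2
    have hvw : v < w := (le_max_right _ _).trans_lt hw1
    obtain ⟨u, hu1, hu2⟩ : ∃ u, w / (1 + w) < u ∧ u < v := by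
      refine exists_between ?_
      rw [div_lt_iff₀ (by linarith)]
      linarith
    have hu0 : 0 < u := lt_trans (div_pos (by linarith) (by linarith)) hu1
    rw [div_lt_iff₀ (by linarith)] at hu1
    refine BaryApprox.not_vExp_lt_of_lt_vHatExp hb2 hS hcard hξ hu0 (hu2.trans hvw)
      (by linarith) (lt_of_lt_of_le (EReal.coe_lt_coe_iff.2 hu2) h1) ?_
    rw [h2]
    exact EReal.coe_lt_coe_iff.2 ((le_max_left _ _).trans_lt hw1)
  · refine le_antisymm ((dimH_mono ?_).trans
      (BaryApprox.dimH_setOf_vHatExp_eq_inter_vExp_eq_le hb2 hS hcard hv hv1 hle))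
      ((BaryApprox.le_dimH_setOf_vHatExp_eq_inter_vExp_eq hb2 hS hcard hdigit hv hv1 hle).trans
        (dimH_mono ?_))
    · exact fun ξ hξ => ⟨hξ.1.1, hξ.1.2, hξ.2.2⟩
    · exact fun ξ hξ => ⟨⟨hξ.1, hξ.2.1⟩, hξ.1, hξ.2.2⟩
  · have h := (dimH_mono (hsub 1)).trans
      (BaryApprox.dimH_setOf_le_vHatExp_le hb2 hS hcard zero_le_one)
    simpa using h
  · have h1 := BaryApprox.le_dimH_setOf_vHatExp_eq hb2 hS hcard hdigit hv hv1
    have h2 := BaryApprox.dimH_setOf_le_vHatExp_le hb2 hS hcard hv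
    have h3 := dimH_mono (hsub v)
    exact ⟨le_antisymm h2 (h1.trans h3), le_antisymm (h3.trans h2) h1⟩
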